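/- Let $\mathbb O$ be the octonions with their inner product $x\cdot y$, norm $|x|$, conjugation $C(x)=\bar x=2(x\cdot 1)1-x$, and left and right multiplications $L_u(x)=ux$, $R_u(x)=xu$. Let $\mathfrak{spin}(8)$ be the Lie algebra, consisting of triples $a=(a_1,a_2,a_3)$, of the group of triples $(g_1,g_2,g_3)\in SO(\mathbb O)^3$ with $g_2(xy)=g_1(x)g_3(y)$ for all $x,y\in\mathbb O$. Write elements of $\mathbb O^4$ as columns $\mathbf z=(x_1,y_1,x_2,y_2)$. For $x,y,z\in\mathbb R$, $u,v,w\in\mathbb O$, $a\in\mathfrak{spin}(8)$ put $$A=\begin{pmatrix} a_1+x&CR_u&y&CR_v\\ -CL_u&a_3+x&CL_v&-y\\ z&CR_w&a_1-x&CR_u\\ CL_w&-z&-CL_u&a_3-x\end{pmatrix}\in\operatorname{End}_{\mathbb R}(\mathbb O^4);$$ these $A$ form $\mathfrak{spin}(10,1)$, and those with $x=0$, $z=-y$, $w=-v$ form $\mathfrak{spin}(10)$. Let $\mathrm{Spin}(10)$ be the connected subgroup with Lie algebra $\mathfrak{spin}(10)$ (the group generated by $\exp\mathfrak{spin}(10)$),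 and let $\mathrm{Spin}(10,1)$ be the subgroup of $GL_{\mathbb R}(\mathbb O^4)$ (in fact of $SL_{\mathbb R}(\mathbb O^4)$) generated by $\mathrm{Spin}(10)$ and the maps $\operatorname{diag}(t,t,t^{-1},t^{-1})$, $t>0$. On $\mathbb R^{2+1}\oplus\mathbb O$ put $(a_1,a_2,a_3,\mathbf x)\cdot(b_1,b_2,b_3,\mathbf y)=-2(a_1b_3+a_3b_1)+a_2b_2+\mathbf x\cdot\mathbf y$. Let $SO(10,1)$ be the group of linear maps of determinant one preserving this form, and $SO^\uparrow(10,1)$ its identity component. A vector $b$ is called future-directed if $b\cdot(1,0,1,0)<0$; the forward light cone consists of the future-directed $b$ with $b\cdot b=0$, and $b$ is timelike if $b\cdot b<0$. With $q^*(\cdot)=\langle q,\cdot\rangle$, put $$\rho'(A)=\begin{pmatrix}2x&y&0&\bar v^*\\ 2z&0&2y&2\bar u^*\\ 0&z&-2x&\bar w^*\\ 2\bar w&-2\bar u&2\bar v&a_2\end{pmatrix}.$$ Finally, let $$\sigma(\mathbf z)=\bigl(|x_1|^2+|y_1|^2,\;2(x_1\cdot x_2-y_1\cdot y_2),\;|x_2|^2+|y_2|^2,\;2(x_1y_2+x_2y_1)\bigr),$$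 $$p(\mathbf z)=|x_1|^2|x_2|^2+|y_1|^2|y_2|^2-(x_1\cdot x_2+y_1\cdot y_2)^2+2(x_1y_1)\cdot(x_2y_2).$$ Then $\exp A\in\mathrm{Spin}(10,1)$ for all $A\in\mathfrak{spin}(10,1)$, and there is exactly one continuous homomorphism $\rho:\mathrm{Spin}(10,1)\to SO^\uparrow(10,1)$ that induces $\rho'$ on Lie algebras, i.e. with $\rho(\exp A)=\exp\rho'(A)$ for all $A\in\mathfrak{spin}(10,1)$. Moreover: 1. $\rho$ is a double cover (a covering map all of whose fibres have exactly two points); 2. $\sigma(g\mathbf z)=\rho(g)\,\sigma(\mathbf z)$ for all $g\in\mathrm{Spin}(10,1)$, $\mathbf z\in\mathbb O^4$; 3. $p(\mathbf z)=-\tfrac14\,\sigma(\mathbf z)\cdot\sigma(\mathbf z)$ for all $\mathbf z$, and $p(g\mathbf z)=p(\mathbf z)$ for all $g\in\mathrm{Spin}(10,1)$; 4. $\sigma$ maps the $\mathrm{Spin}(10,1)$-orbit of each $\mathbf z$ onto the $SO^\uparrow(10,1)$-orbit of $\sigma(\mathbf z)$; 5. the image of $\sigma$ is the union of the origin, the forward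 light cone and the set of future-directed timelike vectors. -/

import Mathlib

open scoped Quaternion RealInnerProductSpace

noncomputable section

namespace Bryant

/-! ### The octonions -/

/-- The octonions, as pairs of quaternions, with the Euclidean inner product of `ℝ⁸`. -/
def Octonion : Type := WithLp 2 (ℍ[ℝ] × ℍ[ℝ])

instance : NormedAddCommGroup Octonion :=
  inferInstanceAs (NormedAddCommGroup (WithLp 2 (ℍ[ℝ] × ℍ[ℝ])))

instance : InnerProductSpace ℝ Octonion :=
  inferInstanceAs (InnerProductSpace ℝ (WithLp 2 (ℍ[ℝ] × ℍ[ℝ])))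

instance : NormedSpace ℝ Octonion := InnerProductSpace.toNormedSpace

instance : FiniteDimensional ℝ Octonion :=
  inferInstanceAs (FiniteDimensional ℝ (WithLp 2 (ℍ[ℝ] × ℍ[ℝ])))

/-- The octonion `(a, b)`. -/
def Octonion.mk (a b : ℍ[ℝ]) : Octonion := WithLp.toLp 2 (a, b)

/-- First quaternionic component. -/
def Octonion.fst (x : Octonion) : ℍ[ℝ] := WithLp.fst x

/-- Second quaternionic component. -/
def Octonion.snd (x : Octonion) : ℍ[ℝ] := WithLp.snd x

/-- Cayley–Dickson multiplication `(a, b) (c, d) = (a c - d̄ b, d a + b c̄)`. -/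
instance : Mul Octonion where
  mul x y := Octonion.mk
    (x.fst * y.fst - star y.snd * x.snd) (y.snd * x.fst + x.snd * star y.fst)

theorem Octonion.ext' {x y : Octonion} (h : x.fst = y.fst) (h' : x.snd = y.snd) : x = y :=
  WithLp.ofLp_injective 2 (Prod.ext h h')

theorem Octonion.fst_mul (x y : Octonion) :
    (x * y).fst = x.fst * y.fst - star y.snd * x.snd := rfl

theorem Octonion.snd_mul (x y : Octonion) :
    (x * y).snd = y.snd * x.fst + x.snd * star y.fst := rfl

theorem Octonion.fst_add (x y : Octonion) : (x + y).fst = x.fst + y.fst := rfl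

theorem Octonion.snd_add (x y : Octonion) : (x + y).snd = x.snd + y.snd := rfl

theorem Octonion.fst_smul (t : ℝ) (x : Octonion) : (t • x).fst = t • x.fst := rfl

theorem Octonion.snd_smul (t : ℝ) (x : Octonion) : (t • x).snd = t • x.snd := rfl


instance : One Octonion where
  one := Octonion.mk 1 0

/-- Real-linear endomorphisms of the octonions. -/
abbrev EndO : Type := Octonion →L[ℝ] Octonion

/-- Left multiplication `L_u : x ↦ u x`. -/
def L (u : Octonion) : EndO :=
  LinearMap.toContinuousLinearMap
    { toFun := fun x => u * x
      map_add' := fun x y => by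
        apply Octonion.ext' <;>
          simp only [Octonion.fst_mul, Octonion.snd_mul, Octonion.fst_add, Octonion.snd_add,
            star_add] <;> noncomm_ring
      map_smul' := fun t x => by
        apply Octonion.ext' <;>
          simp [Octonion.fst_mul, Octonion.snd_mul, Octonion.fst_smul, Octonion.snd_smul,
            smul_sub] }

/-- Right multiplication `R_u : x ↦ x u`. -/
def R (u : Octonion) : EndO :=
  LinearMap.toContinuousLinearMap
    { toFun := fun x => x * u
      map_add' := fun x y => by
        apply Octonion.ext' <;>
          simp only [Octonion.fst_mul, Octonion.snd_mul, Octonion.fst_add, Octonion.snd_add] <;>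
          noncomm_ring
      map_smul' := fun t x => by
        apply Octonion.ext' <;>
          simp [Octonion.fst_mul, Octonion.snd_mul, Octonion.fst_smul, Octonion.snd_smul,
            smul_sub] }

/-- Octonionic conjugation `C : x ↦ x̄ = 2 ⟨x, 1⟩ 1 - x`. -/
def C : EndO := (2 : ℝ) • (innerSL ℝ (1 : Octonion)).smulRight (1 : Octonion) - 1

/-! ### `Spin(8)` through triality, and its Lie algebra -/

/-- Membership in `SO(𝕆) = SO(8)`. -/
def IsSO (g : EndO) : Prop :=
  (∀ x, ‖g x‖ = ‖x‖) ∧ LinearMap.det (g : Octonion →ₗ[ℝ] Octonion) = 1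

/-- The group `H ≅ Spin(8)` of triples `(g₁, g₂, g₃) ∈ SO(8)³` with `g₂ (x y) = g₁ x · g₃ y`. -/
def H : Set (EndO × EndO × EndO) :=
  {g | IsSO g.1 ∧ IsSO g.2.1 ∧ IsSO g.2.2 ∧ ∀ x y : Octonion, g.2.1 (x * y) = g.1 x * g.2.2 y}

/-- The Lie algebra `𝔰𝔭𝔦𝔫(8)` of the closed group `H`, as triples `(a₁, a₂, a₃)`: the tangent
vectors all of whose exponentials lie in `H`. -/
def spin8 : Set (EndO × EndO × EndO) :=
  {a | ∀ t : ℝ, (NormedSpace.exp (t • a.1), NormedSpace.exp (t • a.2.1),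
    NormedSpace.exp (t • a.2.2)) ∈ H}

/-! ### Spinors and the group `Spin(10,1)` -/

/-- The spinor space `𝕆⁴`; the coordinates are `(x₁, y₁, x₂, y₂)`. -/
abbrev Spinor : Type := Fin 4 → Octonion

abbrev EndSpinor : Type := Spinor →L[ℝ] Spinor

/-- The endomorphism of `𝕆⁴` given by a 4-by-4 matrix of endomorphisms of `𝕆`. -/
def ofBlocks (M : Matrix (Fin 4) (Fin 4) EndO) : EndSpinor :=
  ContinuousLinearMap.pi fun i => ∑ j, (M i j).comp (ContinuousLinearMap.proj j)

/-- The general element of `𝔰𝔭𝔦𝔫(10)`, for `r ∈ ℝ`, `u, v ∈ 𝕆`, `a = (a₁, a₂, a₃) ∈ 𝔰𝔭𝔦𝔫(8)`. -/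
def spin10Matrix (r : ℝ) (u v : Octonion) (a : EndO × EndO × EndO) : EndSpinor :=
  ofBlocks
    !![a.1,          C * R u,      -(r • 1),     -(C * R v);
       -(C * L u),   a.2.2,        -(C * L v),   r • 1;
       r • 1,        C * R v,      a.1,          C * R u;
       C * L v,      -(r • 1),     -(C * L u),   a.2.2]

/-- `Spin(10)`: the connected subgroup of `GL(𝕆⁴)` with Lie algebra `𝔰𝔭𝔦𝔫(10)`, that is, the
subgroup generated by the exponentials of the elements of `𝔰𝔭𝔦𝔫(10)`. -/
def Spin10 : Subgroup EndSpinorˣ :=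
  Subgroup.closure {g | ∃ (r : ℝ) (u v : Octonion), ∃ a ∈ spin8,
    (g : EndSpinor) = NormedSpace.exp (spin10Matrix r u v a)}

/-- The elements `diag(t I₁₆, t⁻¹ I₁₆)`, `t > 0`. -/
def boosts : Set EndSpinorˣ :=
  {g | ∃ t : ℝ, 0 < t ∧ (g : EndSpinor) = ofBlocks
    !![t • 1, 0,     0,       0;
       0,     t • 1, 0,       0;
       0,     0,     t⁻¹ • 1, 0;
       0,     0,     0,       t⁻¹ • 1]}

/-- `Spin(10,1)`: the subgroup of `GL(𝕆⁴)` generated by `Spin(10)` and the boosts. -/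
def Spin101 : Subgroup EndSpinorˣ :=
  Subgroup.closure ((Spin10 : Set EndSpinorˣ) ∪ boosts)

/-- Parameters `x, y, z ∈ ℝ`, `u, v, w ∈ 𝕆`, `a = (a₁, a₂, a₃) ∈ 𝔰𝔭𝔦𝔫(8)` of an element of
the 55-dimensional Lie algebra `𝔰𝔭𝔦𝔫(10,1)`. -/
structure Spin101Param where
  x : ℝ
  y : ℝ
  z : ℝ
  u : Octonion
  v : Octonion
  w : Octonion
  a : EndO × EndO × EndO
  ha : a ∈ spin8

/-- The element of `𝔰𝔭𝔦𝔫(10,1) ⊆ End(𝕆⁴)` with the given parameters. -/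
def Spin101Param.toSpinor (P : Spin101Param) : EndSpinor :=
  ofBlocks
    !![P.a.1 + P.x • 1,  C * R P.u,           P.y • 1,           C * R P.v;
       -(C * L P.u),     P.a.2.2 + P.x • 1,   C * L P.v,         -(P.y • 1);
       P.z • 1,          C * R P.w,           P.a.1 - P.x • 1,   C * R P.u;
       C * L P.w,        -(P.z • 1),          -(C * L P.u),      P.a.2.2 - P.x • 1]

/-! ### Vectors and the group `SO↑(10,1)` -/

/-- The vector space `ℝ^{2+1} ⊕ 𝕆 = ℝ^{10+1}`, with coordinates `(a₁, a₂, a₃, x)`. -/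
abbrev Vec : Type := ℝ × ℝ × ℝ × Octonion

abbrev EndVec : Type := Vec →L[ℝ] Vec

/-- The Lorentzian inner product `-2 (a₁ b₃ + a₃ b₁) + a₂ b₂ + x · y`. -/
def lor (a b : Vec) : ℝ :=
  -2 * (a.1 * b.2.2.1 + a.2.2.1 * b.1) + a.2.1 * b.2.1 + ⟪a.2.2.2, b.2.2.2⟫

/-- `SO(10,1)`: the linear maps of determinant one that preserve the inner product. -/
def SO101 : Subgroup EndVecˣ where
  carrier := {g | LinearMap.det ((g : EndVec) : Vec →ₗ[ℝ] Vec) = 1 ∧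
    ∀ a b : Vec, lor ((g : EndVec) a) ((g : EndVec) b) = lor a b}
  mul_mem' := by
    rintro g h ⟨hg, hg'⟩ ⟨hh, hh'⟩
    refine ⟨?_, fun a b => ?_⟩
    · rw [Units.val_mul, ContinuousLinearMap.toLinearMap_mul, map_mul, hg, hh, one_mul]
    · rw [Units.val_mul, mul_apply_eq_comp, mul_apply_eq_comp, hg', hh']
  one_mem' := ⟨by simp, fun a b => rfl⟩
  inv_mem' := by
    rintro g ⟨hg, hg'⟩
    have key : ∀ a : Vec, (g : EndVec) (((g⁻¹ : EndVecˣ) : EndVec) a) = a := fun a => by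
      rw [← mul_apply_eq_comp, Units.mul_inv, one_apply_eq_self]
    refine ⟨?_, fun a b => ?_⟩
    · have h : LinearMap.det (((g * g⁻¹ : EndVecˣ) : EndVec) : Vec →ₗ[ℝ] Vec) = 1 := by simp
      rwa [Units.val_mul, ContinuousLinearMap.toLinearMap_mul, map_mul, hg, one_mul] at h
    · rw [← hg', key, key]

/-- `SO↑(10,1)`: the identity component of `SO(10,1)`. -/
def SOUp101 : Subgroup EndVecˣ :=
  (Subgroup.connectedComponentOfOne SO101).map SO101.subtype

/-- The element of `𝔰𝔬(10,1) ⊆ End(ℝ^{2+1} ⊕ 𝕆)` attached to the parameters of an element of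
`𝔰𝔭𝔦𝔫(10,1)`. -/
def Spin101Param.toVec (P : Spin101Param) : EndVec :=
  LinearMap.toContinuousLinearMap
    { toFun := fun b =>
        (2 * P.x * b.1 + P.y * b.2.1 + ⟪C P.v, b.2.2.2⟫,
         2 * P.z * b.1 + 2 * P.y * b.2.2.1 + 2 * ⟪C P.u, b.2.2.2⟫,
         P.z * b.2.1 - 2 * P.x * b.2.2.1 + ⟪C P.w, b.2.2.2⟫,
         (2 * b.1) • C P.w - (2 * b.2.1) • C P.u + (2 * b.2.2.1) • C P.v + P.a.2.1 b.2.2.2)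
      map_add' := fun b c => by
        refine Prod.ext ?_ (Prod.ext ?_ (Prod.ext ?_ ?_))
        · simp [inner_add_right]; ring
        · simp [inner_add_right]; ring
        · simp [inner_add_right]; ring
        · simp only [Prod.fst_add, Prod.snd_add, map_add]; module
      map_smul' := fun t b => by
        refine Prod.ext ?_ (Prod.ext ?_ (Prod.ext ?_ ?_))
        · simp [inner_smul_right]; ring
        · simp [inner_smul_right]; ring
        · simp [inner_smul_right]; ring
        · simp only [Prod.smul_fst, Prod.smul_snd, map_smul, smul_eq_mul, RingHom.id_apply]
          module }

/-- `ρ : Spin(10,1) → SO↑(10,1)` is a homomorphism of Lie groups that induces on Lie algebras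
the map `P.toSpinor ↦ P.toVec`. -/
def InducesOnLieAlgebras (ρ : Spin101 →* SOUp101) : Prop :=
  Continuous ρ ∧ ∀ P : Spin101Param, ∃ g : Spin101,
    ((g : EndSpinorˣ) : EndSpinor) = NormedSpace.exp P.toSpinor ∧
    ((ρ g : EndVecˣ) : EndVec) = NormedSpace.exp P.toVec

/-! ### The squaring map, the quartic invariant and the causal structure -/

/-- The squaring map `σ : 𝕆⁴ → ℝ^{2+1} ⊕ 𝕆`, at `(x₁, y₁, x₂, y₂) = (s 0, s 1, s 2, s 3)`. -/
def squaring (s : Spinor) : Vec :=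
  (‖s 0‖ ^ 2 + ‖s 1‖ ^ 2,
   2 * (⟪s 0, s 2⟫ - ⟪s 1, s 3⟫),
   ‖s 2‖ ^ 2 + ‖s 3‖ ^ 2,
   (2 : ℝ) • (s 0 * s 3 + s 2 * s 1))

/-- The quartic polynomial `p` on `𝕆⁴`. -/
def quartic (s : Spinor) : ℝ :=
  ‖s 0‖ ^ 2 * ‖s 2‖ ^ 2 + ‖s 1‖ ^ 2 * ‖s 3‖ ^ 2 - (⟪s 0, s 2⟫ + ⟪s 1, s 3⟫) ^ 2
    + 2 * ⟪s 0 * s 1, s 2 * s 3⟫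

/-- The timelike vector `(1, 0, 1, 0)` that fixes the time orientation. -/
def timeAxis : Vec := (1, 0, 1, 0)

/-- The forward light cone: the future-directed null vectors. -/
def forwardLightCone : Set Vec := {b | lor b b = 0 ∧ lor b timeAxis < 0}

/-- The future-directed timelike vectors. -/
def futureTimelike : Set Vec := {b | lor b b < 0 ∧ lor b timeAxis < 0}

end Bryant

end

noncomputable section

namespace Bryant

theorem Octonion.fst_sub (x y : Octonion) : (x - y).fst = x.fst - y.fst := rfl
theorem Octonion.snd_sub (x y : Octonion) : (x - y).snd = x.snd - y.snd := rfl
theorem Octonion.fst_one : (1 : Octonion).fst = 1 := rfl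
theorem Octonion.snd_one : (1 : Octonion).snd = 0 := rfl

theorem Octonion.inner_eq (x y : Octonion) :
    ⟪x, y⟫ = x.fst.re * y.fst.re + x.fst.imI * y.fst.imI + x.fst.imJ * y.fst.imJ
      + x.fst.imK * y.fst.imK + (x.snd.re * y.snd.re + x.snd.imI * y.snd.imI
      + x.snd.imJ * y.snd.imJ + x.snd.imK * y.snd.imK) := by
  have h : ⟪x, y⟫ = ⟪x.fst, y.fst⟫ + ⟪x.snd, y.snd⟫ := WithLp.prod_inner_apply x y
  rw [h, Quaternion.inner_def, Quaternion.inner_def]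
  simp

theorem C_apply (x : Octonion) : C x = (2 * ⟪1, x⟫) • (1 : Octonion) - x := by
  simp [C, smul_smul]

theorem fst_C (x : Octonion) : (C x).fst = star x.fst := by
  rw [C_apply, Octonion.fst_sub, Octonion.fst_smul, Octonion.inner_eq]
  ext <;> simp [Octonion.fst_one, Octonion.snd_one]
  ring

theorem snd_C (x : Octonion) : (C x).snd = -x.snd := by
  rw [C_apply, Octonion.snd_sub, Octonion.snd_smul]
  simp [Octonion.snd_one]

theorem L_apply (u x : Octonion) : L u x = u * x := rfl
theorem R_apply (u x : Octonion) : R u x = x * u := rfl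

/-- The octonion product as a continuous bilinear map. -/
def mulL : Octonion →L[ℝ] Octonion →L[ℝ] Octonion :=
  LinearMap.toContinuousLinearMap
    { toFun := L
      map_add' := fun x y => by ext z; exact (R z).map_add x y
      map_smul' := fun t x => by ext z; exact (R z).map_smul t x }

theorem mulL_apply (x y : Octonion) : mulL x y = x * y := rfl

scoped instance : NonUnitalNonAssocRing Octonion where
  left_distrib x y z := (L x).map_add y z
  right_distrib x y z := (R z).map_add x y
  zero_mul x := (R x).map_zero
  mul_zero x := (L x).map_zero

scoped instance : IsScalarTower ℝ Octonion Octonion := ⟨fun t x y => (R y).map_smul t x⟩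
scoped instance : SMulCommClass ℝ Octonion Octonion := ⟨fun t x y => ((L x).map_smul t y).symm⟩

scoped instance : MulOneClass Octonion where
  one_mul x := by
    apply Octonion.ext' <;>
      simp [Octonion.fst_mul, Octonion.snd_mul, Octonion.fst_one, Octonion.snd_one]
  mul_one x := by
    apply Octonion.ext' <;>
      simp [Octonion.fst_mul, Octonion.snd_mul, Octonion.fst_one, Octonion.snd_one]

theorem C_C (x : Octonion) : C (C x) = x := by
  apply Octonion.ext' <;> simp [fst_C, snd_C]

theorem C_one : C 1 = 1 := by
  apply Octonion.ext' <;> simp [fst_C, snd_C, Octonion.fst_one, Octonion.snd_one]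

theorem C_mul (x y : Octonion) : C (x * y) = C y * C x := by
  apply Octonion.ext' <;> simp [fst_C, snd_C, Octonion.fst_mul, Octonion.snd_mul, add_comm]

theorem inner_C_C (x y : Octonion) : ⟪C x, C y⟫ = ⟪x, y⟫ := by
  simp [Octonion.inner_eq, fst_C, snd_C]

theorem inner_mul_left (x y z : Octonion) : ⟪x * y, z⟫ = ⟪y, C x * z⟫ := by
  simp [Octonion.inner_eq, fst_C, snd_C, Octonion.fst_mul, Octonion.snd_mul]
  ring

theorem inner_mul_right (x y z : Octonion) : ⟪x * y, z⟫ = ⟪x, z * C y⟫ := by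
  rw [← inner_C_C, C_mul, inner_mul_left, ← inner_C_C (C x), C_mul, C_C, C_C, C_C]

theorem C_mul_mul_add (x y z : Octonion) : C x * (y * z) + C y * (x * z) = (2 * ⟪x, y⟫) • z := by
  apply Octonion.ext' <;> ext <;>
  simp [Octonion.inner_eq, fst_C, snd_C, Octonion.fst_mul, Octonion.snd_mul, Octonion.fst_add,
      Octonion.snd_add, Octonion.fst_smul, Octonion.snd_smul] <;>
  ring

theorem mul_mul_C_add (x y z : Octonion) : (z * y) * C x + (z * x) * C y = (2 * ⟪x, y⟫) • z := by
  have h := congrArg C (C_mul_mul_add (C x) (C y) (C z))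
  simpa only [map_add, C_mul, C_C, map_smul, inner_C_C] using h

theorem mul_C_mul_add (x y z : Octonion) : x * (C y * z) + y * (C x * z) = (2 * ⟪x, y⟫) • z := by
  simpa only [C_C, inner_C_C] using C_mul_mul_add (C x) (C y) z

theorem mul_C_mul (x z : Octonion) : x * (C x * z) = (‖x‖ ^ 2) • z := by
  have h := mul_C_mul_add x x z
  rw [real_inner_self_eq_norm_sq, ← two_smul ℝ (x * (C x * z)), mul_smul] at h
  exact smul_right_injective _ two_ne_zero h

theorem C_mul_mul (x z : Octonion) : C x * (x * z) = (‖x‖ ^ 2) • z := by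
  have h := C_mul_mul_add x x z
  rw [real_inner_self_eq_norm_sq, ← two_smul ℝ (C x * (x * z)), mul_smul] at h
  exact smul_right_injective _ two_ne_zero h

theorem mul_mul_C (x z : Octonion) : (z * x) * C x = (‖x‖ ^ 2) • z := by
  have h := mul_mul_C_add x x z
  rw [real_inner_self_eq_norm_sq, ← two_smul ℝ (z * x * C x), mul_smul] at h
  exact smul_right_injective _ two_ne_zero h

theorem norm_C (x : Octonion) : ‖C x‖ = ‖x‖ := by
  rw [← sq_eq_sq₀ (norm_nonneg _) (norm_nonneg _), ← real_inner_self_eq_norm_sq, inner_C_C,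
    real_inner_self_eq_norm_sq]

theorem norm_mul_sq (x y : Octonion) : ‖x * y‖ ^ 2 = ‖x‖ ^ 2 * ‖y‖ ^ 2 := by
  rw [← real_inner_self_eq_norm_sq, inner_mul_left, C_mul_mul, inner_smul_right,
    real_inner_self_eq_norm_sq]

theorem norm_one' : ‖(1 : Octonion)‖ = 1 := by
  rw [← sq_eq_sq₀ (norm_nonneg _) zero_le_one, ← real_inner_self_eq_norm_sq, Octonion.inner_eq]
  simp [Octonion.fst_one, Octonion.snd_one]

theorem inner_mul_mul_add (x y z w : Octonion) :
    ⟪x * z, y * w⟫ + ⟪x * w, y * z⟫ = 2 * ⟪x, y⟫ * ⟪z, w⟫ := by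
  rw [inner_mul_left, inner_mul_left]
  have h := congrArg (fun t => ⟪z, t⟫) (C_mul_mul_add x y w)
  simp only [inner_add_right, inner_smul_right] at h
  have h2 : ⟪w, C x * (y * z)⟫ = ⟪z, C y * (x * w)⟫ := by
    rw [← inner_mul_left, real_inner_comm, inner_mul_left]
  rw [h2, h]

section Exponential

variable {E : Type*} [NormedAddCommGroup E] [NormedSpace ℝ E] [CompleteSpace E]

theorem hasDerivAt_exp_apply (M : E →L[ℝ] E) (v : E) (t : ℝ) :
    HasDerivAt (fun t : ℝ => NormedSpace.exp (t • M) v) (M (NormedSpace.exp (t • M) v)) t := by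
  have h := (hasDerivAt_exp_smul_const' M t).clm_apply (hasDerivAt_const t v)
  simpa using h

theorem exp_neg_mul_exp {A : Type*} [NormedRing A] [NormedAlgebra ℝ A] [CompleteSpace A] (M : A) :
    NormedSpace.exp (-M) * NormedSpace.exp M = 1 := by
  let _ : NormedAlgebra ℚ A := NormedAlgebra.restrictScalars ℚ ℝ A
  rw [← NormedSpace.exp_add_of_commute (Commute.refl M).neg_left, neg_add_cancel,
    NormedSpace.exp_zero]

/-- The exponential as a unit. -/
def expUnit {A : Type*} [NormedRing A] [NormedAlgebra ℝ A] [CompleteSpace A] (M : A) : Aˣ where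
  val := NormedSpace.exp M
  inv := NormedSpace.exp (-M)
  val_inv := by simpa using exp_neg_mul_exp (-M)
  inv_val := exp_neg_mul_exp M

/-- A solution of `R' = N R`, `R 0 = 1` is the one-parameter group of `N`. -/
theorem eq_exp_of_hasDerivAt {A : Type*} [NormedRing A] [NormedAlgebra ℝ A] [CompleteSpace A]
    {N : A} {r : ℝ → A} (h0 : r 0 = 1) (hr : ∀ t, HasDerivAt r (N * r t) t) (t : ℝ) :
    NormedSpace.exp (t • N) = r t := by
  have hd : ∀ t : ℝ, HasDerivAt (fun t : ℝ => NormedSpace.exp (t • -N) * r t) 0 t := fun t => by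
    have h := (hasDerivAt_exp_smul_const (-N) t).mul (hr t)
    refine h.congr_deriv ?_
    noncomm_ring
  have hc := is_const_of_deriv_eq_zero (fun t => (hd t).differentiableAt)
    (fun t => (hd t).deriv) t 0
  simp only [zero_smul, NormedSpace.exp_zero, h0, one_mul] at hc
  rw [smul_neg] at hc
  calc NormedSpace.exp (t • N) = NormedSpace.exp (t • N) * (NormedSpace.exp (-(t • N)) * r t) := by
        rw [hc, mul_one]
    _ = r t := by
        rw [← mul_assoc]
        simpa using congrArg (· * r t) (exp_neg_mul_exp (-(t • N)))

theorem exp_smul_of_cube_eq_neg {A : Type*} [NormedRing A] [NormedAlgebra ℝ A] [CompleteSpace A]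
    {N : A} (hN : N * (N * N) = -N) (t : ℝ) :
    NormedSpace.exp (t • N) = 1 + Real.sin t • N + (1 - Real.cos t) • (N * N) := by
  refine eq_exp_of_hasDerivAt (r := fun t => 1 + Real.sin t • N + (1 - Real.cos t) • (N * N))
    (by simp) (fun t => ?_) t
  have h := (((Real.hasDerivAt_sin t).smul_const N).const_add 1).add
    (((Real.hasDerivAt_cos t).const_sub 1).smul_const (N * N))
  refine h.congr_deriv ?_
  simp only [mul_add, mul_one, mul_smul_comm, hN]
  module

theorem exp_smul_of_sq_eq_one {A : Type*} [NormedRing A] [NormedAlgebra ℝ A] [CompleteSpace A]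
    {N : A} (hN : N * N = 1) (t : ℝ) :
    NormedSpace.exp (t • N) = Real.cosh t • 1 + Real.sinh t • N := by
  refine eq_exp_of_hasDerivAt (r := fun t => Real.cosh t • 1 + Real.sinh t • N)
    (by simp) (fun t => ?_) t
  have h := ((Real.hasDerivAt_cosh t).smul_const (1 : A)).add
    ((Real.hasDerivAt_sinh t).smul_const N)
  refine h.congr_deriv ?_
  simp only [mul_add, mul_one, mul_smul_comm, hN]
  module

end Exponential

theorem hasDerivAt_mul {f g : ℝ → Octonion} {f' g' : Octonion} {t : ℝ} (hf : HasDerivAt f f' t)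
    (hg : HasDerivAt g g' t) : HasDerivAt (fun t => f t * g t) (f t * g' + f' * g t) t := by
  have h := mulL.hasFDerivAt_of_bilinear hf.hasFDerivAt hg.hasFDerivAt
  simpa [mulL_apply] using h.hasDerivAt


theorem skew_of_isSO_exp {b : EndO} (hb : ∀ t : ℝ, IsSO (NormedSpace.exp (t • b)))
    (x y : Octonion) : ⟪b x, y⟫ + ⟪x, b y⟫ = 0 := by
  have key : ∀ x, ⟪b x, x⟫ = 0 := fun x => by
    have h := (hasDerivAt_exp_apply b x 0).norm_sq
    have hc : (fun t : ℝ => ‖NormedSpace.exp (t • b) x‖ ^ 2) = fun _ => ‖x‖ ^ 2 := by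
      funext t; rw [(hb t).1 x]
    have h2 := h.unique (hc ▸ hasDerivAt_const (0 : ℝ) (‖x‖ ^ 2))
    simp only [zero_smul, NormedSpace.exp_zero, one_apply_eq_self] at h2
    rw [real_inner_comm]; linarith
  have h := key (x + y)
  simp only [map_add, inner_add_left, inner_add_right, key] at h
  rw [real_inner_comm (b y) x]
  linarith

theorem spin8_skew_fst {a : EndO × EndO × EndO} (ha : a ∈ spin8) (x y : Octonion) :
    ⟪a.1 x, y⟫ + ⟪x, a.1 y⟫ = 0 :=
  skew_of_isSO_exp (fun t => (ha t).1) x y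

theorem spin8_skew_snd {a : EndO × EndO × EndO} (ha : a ∈ spin8) (x y : Octonion) :
    ⟪a.2.1 x, y⟫ + ⟪x, a.2.1 y⟫ = 0 :=
  skew_of_isSO_exp (fun t => (ha t).2.1) x y

theorem spin8_skew_thd {a : EndO × EndO × EndO} (ha : a ∈ spin8) (x y : Octonion) :
    ⟪a.2.2 x, y⟫ + ⟪x, a.2.2 y⟫ = 0 :=
  skew_of_isSO_exp (fun t => (ha t).2.2.1) x y

theorem spin8_mul {a : EndO × EndO × EndO} (ha : a ∈ spin8) (x y : Octonion) :
    a.2.1 (x * y) = x * a.2.2 y + a.1 x * y := by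
  have h := hasDerivAt_mul (hasDerivAt_exp_apply a.1 x 0) (hasDerivAt_exp_apply a.2.2 y 0)
  have hc : (fun t : ℝ => NormedSpace.exp (t • a.1) x * NormedSpace.exp (t • a.2.2) y)
      = fun t => NormedSpace.exp (t • a.2.1) (x * y) := by
    funext t; exact ((ha t).2.2.2 x y).symm
  rw [hc] at h
  simpa using (hasDerivAt_exp_apply a.2.1 (x * y) 0).unique h

theorem zero_mem_spin8 : (0 : EndO × EndO × EndO) ∈ spin8 := by
  intro t
  have h : IsSO 1 := ⟨fun x => rfl, by simp⟩
  simpa [H] using h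

/-- The differential of the squaring map. -/
def dsquaring (s d : Spinor) : Vec :=
  (2 * ⟪s 0, d 0⟫ + 2 * ⟪s 1, d 1⟫,
   2 * (⟪s 0, d 2⟫ + ⟪d 0, s 2⟫ - (⟪s 1, d 3⟫ + ⟪d 1, s 3⟫)),
   2 * ⟪s 2, d 2⟫ + 2 * ⟪s 3, d 3⟫,
   (2 : ℝ) • (s 0 * d 3 + d 0 * s 3 + (s 2 * d 1 + d 2 * s 1)))

theorem hasDerivAt_squaring {c : ℝ → Spinor} {d : Spinor} {t : ℝ} (hc : HasDerivAt c d t) :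
    HasDerivAt (fun t => squaring (c t)) (dsquaring (c t) d) t := by
  have h := fun i => hasDerivAt_pi.1 hc i
  refine HasDerivAt.prodMk ?_ (HasDerivAt.prodMk ?_ (HasDerivAt.prodMk ?_ ?_))
  · exact (h 0).norm_sq.add (h 1).norm_sq
  · exact (((h 0).inner ℝ (h 2)).sub ((h 1).inner ℝ (h 3))).const_mul 2
  · exact (h 2).norm_sq.add (h 3).norm_sq
  · exact ((hasDerivAt_mul (h 0) (h 3)).add (hasDerivAt_mul (h 2) (h 1))).const_smul (2 : ℝ)

theorem ofBlocks_apply (M : Matrix (Fin 4) (Fin 4) EndO) (s : Spinor) (i : Fin 4) :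
    ofBlocks M s i = M i 0 (s 0) + M i 1 (s 1) + M i 2 (s 2) + M i 3 (s 3) := by
  simp [ofBlocks, Fin.sum_univ_four]

section ToSpinor
variable (P : Spin101Param) (s : Spinor)

theorem toSpinor_apply_zero : P.toSpinor s 0 =
    P.a.1 (s 0) + P.x • s 0 + C (s 1 * P.u) + P.y • s 2 + C (s 3 * P.v) := by
  rw [Spin101Param.toSpinor, ofBlocks_apply]
  simp [mul_apply_eq_comp, R_apply]

theorem toSpinor_apply_one : P.toSpinor s 1 =
    -C (P.u * s 0) + (P.a.2.2 (s 1) + P.x • s 1) + C (P.v * s 2) - P.y • s 3 := by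
  rw [Spin101Param.toSpinor, ofBlocks_apply]
  simp [mul_apply_eq_comp, L_apply, sub_eq_add_neg]

theorem toSpinor_apply_two : P.toSpinor s 2 =
    P.z • s 0 + C (s 1 * P.w) + (P.a.1 (s 2) - P.x • s 2) + C (s 3 * P.u) := by
  rw [Spin101Param.toSpinor, ofBlocks_apply]
  simp [mul_apply_eq_comp, R_apply]

theorem toSpinor_apply_three : P.toSpinor s 3 =
    C (P.w * s 0) - P.z • s 1 - C (P.u * s 2) + (P.a.2.2 (s 3) - P.x • s 3) := by
  rw [Spin101Param.toSpinor, ofBlocks_apply]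
  simp [mul_apply_eq_comp, L_apply, sub_eq_add_neg]

end ToSpinor

theorem toVec_apply (P : Spin101Param) (b : Vec) : P.toVec b =
    (2 * P.x * b.1 + P.y * b.2.1 + ⟪C P.v, b.2.2.2⟫,
     2 * P.z * b.1 + 2 * P.y * b.2.2.1 + 2 * ⟪C P.u, b.2.2.2⟫,
     P.z * b.2.1 - 2 * P.x * b.2.2.1 + ⟪C P.w, b.2.2.2⟫,
     (2 * b.1) • C P.w - (2 * b.2.1) • C P.u + (2 * b.2.2.1) • C P.v + P.a.2.1 b.2.2.2) := rfl

theorem inner_C_mul_right (x y u : Octonion) : ⟪x, C (y * u)⟫ = ⟪C u, x * y⟫ := by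
  rw [C_mul, real_inner_comm, inner_mul_right, C_C]

theorem inner_C_mul_left (x y u : Octonion) : ⟪y, C (u * x)⟫ = ⟪C u, x * y⟫ := by
  rw [C_mul, real_inner_comm, inner_mul_left, C_C]

theorem dsquaring_toSpinor (P : Spin101Param) (s : Spinor) :
    dsquaring s (P.toSpinor s) = P.toVec (squaring s) := by
  have h1 := spin8_skew_fst P.ha
  have h3 := spin8_skew_thd P.ha
  have h2 := spin8_mul P.ha
  rw [toVec_apply]
  simp only [dsquaring, squaring, toSpinor_apply_zero, toSpinor_apply_one, toSpinor_apply_two,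
    toSpinor_apply_three]
  have e1 : ∀ x, ⟪x, P.a.1 x⟫ = 0 := fun x => by
    have := h1 x x; rw [real_inner_comm] at this; linarith
  have e3 : ∀ x, ⟪x, P.a.2.2 x⟫ = 0 := fun x => by
    have := h3 x x; rw [real_inner_comm] at this; linarith
  refine Prod.ext ?_ (Prod.ext ?_ (Prod.ext ?_ ?_))
  · simp only [inner_add_right, inner_sub_right, inner_smul_right, inner_neg_right, e1, e3,
      inner_C_mul_right _ _ P.u, inner_C_mul_left _ _ P.u, inner_C_mul_right _ _ P.v,
      inner_C_mul_left _ _ P.v, real_inner_self_eq_norm_sq]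
    ring
  · have k1 := h1 (s 0) (s 2)
    have k3 := h3 (s 1) (s 3)
    rw [real_inner_comm] at k1 k3
    simp only [real_inner_comm (s 2) (_ + _), real_inner_comm (s 3) (_ - _), inner_add_right,
      inner_sub_right, inner_smul_right, inner_neg_right,
      inner_C_mul_right _ _ P.u, inner_C_mul_left _ _ P.u, inner_C_mul_right _ _ P.v,
      inner_C_mul_left _ _ P.v, inner_C_mul_right _ _ P.w, inner_C_mul_left _ _ P.w,
      real_inner_self_eq_norm_sq, real_inner_comm (s 0) (s 2), real_inner_comm (s 1) (s 3)]
    linear_combination 2 * k1 - 2 * k3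
  · simp only [inner_add_right, inner_sub_right, inner_smul_right, e1, e3,
      inner_C_mul_right _ _ P.u, inner_C_mul_left _ _ P.u, inner_C_mul_right _ _ P.w,
      inner_C_mul_left _ _ P.w, real_inner_self_eq_norm_sq, real_inner_comm (s 0) (s 2),
      real_inner_comm (s 1) (s 3)]
    ring
  · have k1 := mul_C_mul (s 0) (C P.w)
    have k2 := mul_C_mul (s 2) (C P.v)
    have k3 := mul_mul_C (C (s 1)) (C P.w)
    have k4 := mul_mul_C (C (s 3)) (C P.v)
    have k5 := mul_C_mul_add (s 0) (s 2) (C P.u)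
    have k6 := mul_mul_C_add (C (s 1)) (C (s 3)) (C P.u)
    rw [C_C, norm_C] at k3 k4
    rw [C_C, C_C, inner_C_C] at k6
    simp only [C_mul, mul_add, add_mul, mul_sub, sub_mul, mul_neg, smul_mul_assoc,
      mul_smul_comm, map_smul, map_add, h2]
    linear_combination (norm := module) (2 : ℝ) • k1 + (2 : ℝ) • k2 + (2 : ℝ) • k3 + (2 : ℝ) • k4
      - (2 : ℝ) • k5 + (2 : ℝ) • k6

theorem squaring_exp (P : Spin101Param) (s : Spinor) :
    squaring (NormedSpace.exp P.toSpinor s) = NormedSpace.exp P.toVec (squaring s) := by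
  have hd : ∀ t : ℝ, HasDerivAt (fun t : ℝ => NormedSpace.exp (t • -P.toVec)
      (squaring (NormedSpace.exp (t • P.toSpinor) s))) 0 t := fun t => by
    have h := (hasDerivAt_exp_smul_const (-P.toVec) t).clm_apply
      (hasDerivAt_squaring (hasDerivAt_exp_apply P.toSpinor s t))
    rw [dsquaring_toSpinor] at h
    refine h.congr_deriv ?_
    simp [mul_apply_eq_comp]
  have hc := is_const_of_deriv_eq_zero (fun t => (hd t).differentiableAt)
    (fun t => (hd t).deriv) 1 0
  simp only [zero_smul, NormedSpace.exp_zero, one_smul, one_apply_eq_self] at hc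
  rw [← hc, ← mul_apply_eq_comp]
  have h1 := exp_neg_mul_exp (-P.toVec)
  rw [neg_neg] at h1
  rw [h1, one_apply_eq_self]

/-- The Lorentzian inner product as a bilinear form. -/
def lorBilin : LinearMap.BilinForm ℝ Vec :=
  LinearMap.mk₂ ℝ lor
    (fun a b c => by simp [lor, inner_add_left]; ring)
    (fun t a b => by simp [lor, inner_smul_left]; ring)
    (fun a b c => by simp [lor, inner_add_right]; ring)
    (fun t a b => by simp [lor, inner_smul_right]; ring)

theorem lorBilin_apply (a b : Vec) : lorBilin a b = lor a b := rfl

theorem lor_comm (a b : Vec) : lor a b = lor b a := by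
  simp only [lor, real_inner_comm b.2.2.2]; ring

theorem continuous_lor : Continuous fun p : Vec × Vec => lor p.1 p.2 := by
  unfold lor; fun_prop

theorem lorBilin_nondegenerate : lorBilin.Nondegenerate := by
  have h : lorBilin.SeparatingLeft := by
    rintro ⟨a₁, a₂, a₃, x⟩ h
    have h1 := h (0, 0, 1, 0)
    have h2 := h (0, 1, 0, 0)
    have h3 := h (1, 0, 0, 0)
    have h4 := h (0, 0, 0, x)
    simp [lorBilin_apply, lor] at h1 h2 h3 h4
    simp [h1, h2, h3, h4]
  exact ⟨h, fun y hy => h y fun x => by rw [lorBilin_apply, lor_comm]; exact hy x⟩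

theorem det_sq_eq_one {h : EndVec} (hh : ∀ a b, lor (h a) (h b) = lor a b) :
    LinearMap.det (h : Vec →ₗ[ℝ] Vec) ^ 2 = 1 := by
  let b := Module.finBasis ℝ Vec
  have hd := (LinearMap.BilinForm.nondegenerate_iff_det_ne_zero b).1 lorBilin_nondegenerate
  have hc : lorBilin.comp (h : Vec →ₗ[ℝ] Vec) (h : Vec →ₗ[ℝ] Vec) = lorBilin :=
    LinearMap.ext₂ hh
  have h2 := congrArg Matrix.det (LinearMap.BilinForm.toMatrix_comp b b lorBilin
    (h : Vec →ₗ[ℝ] Vec) (h : Vec →ₗ[ℝ] Vec))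
  rw [hc, Matrix.det_mul, Matrix.det_mul, Matrix.det_transpose, LinearMap.det_toMatrix] at h2
  refine mul_left_cancel₀ hd ?_
  linear_combination -h2

theorem lor_toVec (P : Spin101Param) (a b : Vec) : lor (P.toVec a) b + lor a (P.toVec b) = 0 := by
  have h2 := spin8_skew_snd P.ha a.2.2.2 b.2.2.2
  simp only [lor, toVec_apply, inner_add_left, inner_add_right, inner_sub_left, inner_sub_right,
    real_inner_smul_left, real_inner_smul_right]
  simp only [real_inner_comm (C _) a.2.2.2]
  linear_combination h2

theorem lor_exp (P : Spin101Param) (t : ℝ) (a b : Vec) :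
    lor (NormedSpace.exp (t • P.toVec) a) (NormedSpace.exp (t • P.toVec) b) = lor a b := by
  have hd : ∀ t : ℝ, HasDerivAt (fun t : ℝ => lor (NormedSpace.exp (t • P.toVec) a)
      (NormedSpace.exp (t • P.toVec) b)) 0 t := fun t => by
    have h := ((lorBilin.toContinuousBilinearMap).hasFDerivAt_of_bilinear
      (hasDerivAt_exp_apply P.toVec a t).hasFDerivAt
      (hasDerivAt_exp_apply P.toVec b t).hasFDerivAt).hasDerivAt
    refine h.congr_deriv ?_
    have h2 := lor_toVec P (NormedSpace.exp (t • P.toVec) a) (NormedSpace.exp (t • P.toVec) b)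
    simp [lorBilin_apply]
    linarith
  have hc := is_const_of_deriv_eq_zero (fun t => (hd t).differentiableAt)
    (fun t => (hd t).deriv) t 0
  simpa using hc

theorem det_exp_toVec (P : Spin101Param) (t : ℝ) :
    LinearMap.det ((NormedSpace.exp (t • P.toVec) : EndVec) : Vec →ₗ[ℝ] Vec) = 1 := by
  let _ : NormedAlgebra ℚ EndVec := NormedAlgebra.restrictScalars ℚ ℝ EndVec
  have h := NormedSpace.exp_add_of_commute (Commute.refl ((t / 2) • P.toVec))
  rw [← add_smul, add_halves] at h
  rw [h, ContinuousLinearMap.toLinearMap_mul, map_mul, ← sq]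
  exact det_sq_eq_one (lor_exp P _)

theorem expUnit_toVec_mem (P : Spin101Param) (t : ℝ) : expUnit (t • P.toVec) ∈ SO101 :=
  ⟨det_exp_toVec P t, lor_exp P t⟩

theorem continuous_expUnit_smul {A : Type*} [NormedRing A] [NormedAlgebra ℝ A] [CompleteSpace A]
    (M : A) : Continuous fun t : ℝ => expUnit (t • M) := by
  refine Units.continuous_iff.2 ⟨?_, ?_⟩
  · exact continuous_iff_continuousAt.2 fun t => (hasDerivAt_exp_smul_const M t).continuousAt
  · have h : Continuous fun t : ℝ => NormedSpace.exp (t • -M) :=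
      continuous_iff_continuousAt.2 fun t => (hasDerivAt_exp_smul_const (-M) t).continuousAt
    simp only [smul_neg] at h
    exact h

theorem expUnit_toVec_mem_SOUp101 (P : Spin101Param) : expUnit P.toVec ∈ SOUp101 := by
  let f : ℝ → SO101 := fun t => ⟨expUnit (t • P.toVec), expUnit_toVec_mem P t⟩
  have hf : Continuous f := (continuous_expUnit_smul P.toVec).subtype_mk _
  have h0 : f 0 = 1 := Subtype.ext (Units.ext (by simp [f, expUnit]))
  refine ⟨f 1, ?_, by simp [f]⟩
  exact (isPreconnected_range hf).subset_connectedComponent ⟨0, h0⟩ ⟨1, rfl⟩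

theorem SOUp101_le : SOUp101 ≤ SO101 := by
  rintro _ ⟨h, -, rfl⟩
  exact h.2

/-! ### Lifts -/

/-- `g` acts on spinors as `h` acts on their squares. -/
def Lifts (g : EndSpinorˣ) (h : EndVecˣ) : Prop :=
  ∀ s : Spinor, squaring ((g : EndSpinor) s) = (h : EndVec) (squaring s)

theorem lifts_one : Lifts 1 1 := fun _ => rfl

theorem Lifts.mul {g₁ g₂ : EndSpinorˣ} {h₁ h₂ : EndVecˣ} (k₁ : Lifts g₁ h₁) (k₂ : Lifts g₂ h₂) :
    Lifts (g₁ * g₂) (h₁ * h₂) := fun s => by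
  simp only [Units.val_mul, mul_apply_eq_comp, k₁ _, k₂ _]

theorem units_apply_inv_apply {E : Type*} [NormedAddCommGroup E] [NormedSpace ℝ E]
    (g : (E →L[ℝ] E)ˣ) (x : E) : (g : E →L[ℝ] E) (((g⁻¹ : (E →L[ℝ] E)ˣ) : E →L[ℝ] E) x) = x := by
  rw [← mul_apply_eq_comp, Units.mul_inv, one_apply_eq_self]

theorem units_inv_apply_apply {E : Type*} [NormedAddCommGroup E] [NormedSpace ℝ E]
    (g : (E →L[ℝ] E)ˣ) (x : E) : ((g⁻¹ : (E →L[ℝ] E)ˣ) : E →L[ℝ] E) ((g : E →L[ℝ] E) x) = x := by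
  rw [← mul_apply_eq_comp, Units.inv_mul, one_apply_eq_self]

theorem Lifts.inv {g : EndSpinorˣ} {h : EndVecˣ} (k : Lifts g h) : Lifts g⁻¹ h⁻¹ := fun s => by
  have := k (((g⁻¹ : EndSpinorˣ) : EndSpinor) s)
  rw [units_apply_inv_apply] at this
  rw [this, units_inv_apply_apply]

theorem lifts_exp (P : Spin101Param) : Lifts (expUnit P.toSpinor) (expUnit P.toVec) :=
  squaring_exp P

theorem span_range_squaring : Submodule.span ℝ (Set.range squaring) = ⊤ := by
  rw [Submodule.eq_top_iff']
  rintro ⟨a, b, c, x⟩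
  have hm : ∀ s, squaring s ∈ Submodule.span ℝ (Set.range squaring) := fun s =>
    Submodule.subset_span ⟨s, rfl⟩
  have e : ((a, b, c, x) : Vec) = (a - b / 2 - ‖x‖ ^ 2 / 2) • squaring ![1, 0, 0, 0]
      + (c - b / 2 - 1 / 2) • squaring ![0, 0, 1, 0] + (b / 2) • squaring ![1, 0, 1, 0]
      + (1 / 2 : ℝ) • squaring ![x, 0, 0, 1] := by
    refine Prod.ext ?_ (Prod.ext ?_ (Prod.ext ?_ ?_)) <;>
      simp [squaring, norm_one'] <;> ring
  rw [e]
  exact add_mem (add_mem (add_mem (Submodule.smul_mem _ _ (hm _)) (Submodule.smul_mem _ _ (hm _)))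
    (Submodule.smul_mem _ _ (hm _))) (Submodule.smul_mem _ _ (hm _))

theorem Lifts.unique {g : EndSpinorˣ} {h₁ h₂ : EndVecˣ} (k₁ : Lifts g h₁) (k₂ : Lifts g h₂) :
    h₁ = h₂ := by
  refine Units.ext (ContinuousLinearMap.coe_injective
    (LinearMap.ext_on span_range_squaring ?_))
  rintro _ ⟨s, rfl⟩
  exact (k₁ s).symm.trans (k₂ s)

/-- The spinor transformations that cover an element of `SO↑(10,1)`. -/
def liftGroup : Subgroup EndSpinorˣ where
  carrier := {g | ∃ h ∈ SOUp101, Lifts g h}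
  mul_mem' := by
    rintro _ _ ⟨h₁, m₁, k₁⟩ ⟨h₂, m₂, k₂⟩
    exact ⟨_, mul_mem m₁ m₂, k₁.mul k₂⟩
  one_mem' := ⟨1, one_mem _, lifts_one⟩
  inv_mem' := by
    rintro _ ⟨h, m, k⟩
    exact ⟨_, inv_mem m, k.inv⟩

/-- The homomorphism from `liftGroup` to `SO↑(10,1)`. -/
def liftHom : liftGroup →* SOUp101 where
  toFun g := ⟨g.2.choose, g.2.choose_spec.1⟩
  map_one' := Subtype.ext ((1 : liftGroup).2.choose_spec.2.unique lifts_one)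
  map_mul' g₁ g₂ := Subtype.ext ((g₁ * g₂).2.choose_spec.2.unique
    (g₁.2.choose_spec.2.mul g₂.2.choose_spec.2))

theorem lifts_liftHom (g : liftGroup) : Lifts g (liftHom g) := g.2.choose_spec.2

scoped instance : ContinuousMul Octonion where
  continuous_mul := by
    have h : Continuous fun p : Octonion × Octonion => mulL p.1 p.2 := by fun_prop
    simpa only [mulL_apply] using h

theorem continuous_squaring : Continuous squaring := by
  unfold squaring
  fun_prop

theorem continuous_liftHom : Continuous liftHom := by
  have key : Continuous fun g : liftGroup => ((liftHom g : EndVecˣ) : EndVec) := by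
    refine continuous_clm_apply.2 fun b => ?_
    have hb : b ∈ Submodule.span ℝ (Set.range squaring) := by
      rw [span_range_squaring]; exact Submodule.mem_top
    induction hb using Submodule.span_induction with
    | mem x hx =>
      obtain ⟨s, rfl⟩ := hx
      have : (fun g : liftGroup => ((liftHom g : EndVecˣ) : EndVec) (squaring s)) =
          fun g : liftGroup => squaring (((g : EndSpinorˣ) : EndSpinor) s) :=
        funext fun g => (lifts_liftHom g s).symm
      rw [this]
      have hv : Continuous fun g : liftGroup => ((g : EndSpinorˣ) : EndSpinor) :=
        Units.continuous_val.comp continuous_subtype_val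
      exact continuous_squaring.comp (hv.clm_apply continuous_const)
    | zero => simp only [map_zero]; exact continuous_const
    | add x y _ _ hx hy => simp only [map_add]; exact hx.add hy
    | smul t x _ hx => simp only [map_smul]; exact hx.const_smul t
  refine Continuous.subtype_mk (Units.continuous_iff.2 ⟨key, ?_⟩) _
  have h2 := key.comp continuous_inv
  simpa [Function.comp_def] using h2

theorem squaring_add (s d : Spinor) :
    squaring (s + d) = squaring s + squaring d + dsquaring s d := by
  refine Prod.ext ?_ (Prod.ext ?_ (Prod.ext ?_ ?_))
  · simp only [squaring, dsquaring, Pi.add_apply, norm_add_sq_real, Prod.fst_add]; ring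
  · simp only [squaring, dsquaring, Pi.add_apply, inner_add_left, inner_add_right, Prod.fst_add,
      Prod.snd_add]; ring
  · simp only [squaring, dsquaring, Pi.add_apply, norm_add_sq_real, Prod.fst_add,
      Prod.snd_add]; ring
  · simp only [squaring, dsquaring, Pi.add_apply, mul_add, add_mul, Prod.snd_add]; module

/-- The quaternion with the given coordinates. -/
def quat (a b c d : ℝ) : ℍ[ℝ] := ⟨a, b, c, d⟩

@[simp] theorem quat_re (a b c d : ℝ) : (quat a b c d).re = a := rfl
@[simp] theorem quat_imI (a b c d : ℝ) : (quat a b c d).imI = b := rfl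
@[simp] theorem quat_imJ (a b c d : ℝ) : (quat a b c d).imJ = c := rfl
@[simp] theorem quat_imK (a b c d : ℝ) : (quat a b c d).imK = d := rfl

theorem fst_mk (a b : ℍ[ℝ]) : (Octonion.mk a b).fst = a := rfl
theorem snd_mk (a b : ℍ[ℝ]) : (Octonion.mk a b).snd = b := rfl

theorem eq_zero_of_mul_swap {e : Octonion} (h : ∀ x u : Octonion, (x * u) * e = u * (x * e)) :
    e = 0 := by
  have h1 := h (Octonion.mk (quat 0 1 0 0) 0) (Octonion.mk (quat 0 0 1 0) 0)
  have h2 := h (Octonion.mk (quat 0 1 0 0) 0) (Octonion.mk 0 1)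
  have h3 := h (Octonion.mk (quat 0 0 1 0) 0) (Octonion.mk 0 1)
  have h4 := h (Octonion.mk (quat 0 0 0 1) 0) (Octonion.mk 0 1)
  have k1 := congrArg Octonion.fst h1
  have k2 := congrArg Octonion.fst h2
  have k3 := congrArg Octonion.fst h3
  have k4 := congrArg Octonion.fst h4
  simp [Octonion.fst_mul, Octonion.snd_mul, fst_mk, snd_mk, Quaternion.ext_iff] at k1 k2 k3 k4
  obtain ⟨_, _, _, _⟩ := k1
  obtain ⟨_, _⟩ := k2
  obtain ⟨_, _⟩ := k3
  obtain ⟨_, _⟩ := k4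
  apply Octonion.ext'
  · change e.fst = 0
    ext <;> simp <;> linarith
  · change e.snd = 0
    ext <;> simp <;> linarith

theorem exists_real_of_mul_assoc {c : Octonion} (h : ∀ x u : Octonion, c * (x * u) = (c * x) * u) :
    ∃ r : ℝ, c = r • (1 : Octonion) := by
  have h1 := h (Octonion.mk (quat 0 1 0 0) 0) (Octonion.mk (quat 0 0 1 0) 0)
  have h2 := h (Octonion.mk (quat 0 1 0 0) 0) (Octonion.mk 0 1)
  have h3 := h (Octonion.mk (quat 0 0 1 0) 0) (Octonion.mk 0 1)
  have k1 := congrArg Octonion.snd h1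
  have k2 := congrArg Octonion.snd h2
  have k3 := congrArg Octonion.snd h3
  simp [Octonion.fst_mul, Octonion.snd_mul, fst_mk, snd_mk, Quaternion.ext_iff] at k1 k2 k3
  obtain ⟨_, _, _, _⟩ := k1
  obtain ⟨_, _⟩ := k2
  refine ⟨c.fst.re, ?_⟩
  apply Octonion.ext'
  · rw [Octonion.fst_smul, Octonion.fst_one]
    ext <;> simp <;> linarith
  · rw [Octonion.snd_smul, Octonion.snd_one]
    ext <;> simp <;> linarith

section Kernel

variable {k : EndSpinorˣ}

theorem dsquaring_eq_of_kernel (hk : Lifts k 1) (s d : Spinor) :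
    dsquaring ((k : EndSpinor) s) ((k : EndSpinor) d) = dsquaring s d := by
  have h := hk (s + d)
  have hs := hk s
  have hd := hk d
  simp only [Units.val_one, one_apply_eq_self] at h hs hd
  rw [map_add, squaring_add, squaring_add, hs, hd] at h
  exact add_left_cancel h

theorem norm_sq_add_norm_sq_eq_zero {x y : Octonion} (h : ‖x‖ ^ 2 + ‖y‖ ^ 2 = 0) :
    x = 0 ∧ y = 0 := by
  have h1 := sq_nonneg ‖x‖
  have h2 := sq_nonneg ‖y‖
  constructor
  · exact norm_eq_zero.1 (pow_eq_zero_iff two_ne_zero |>.1 (by linarith))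
  · exact norm_eq_zero.1 (pow_eq_zero_iff two_ne_zero |>.1 (by linarith))

theorem kernel_upper (hk : Lifts k 1) {s : Spinor} (h2 : s 2 = 0) (h3 : s 3 = 0) :
    (k : EndSpinor) s 2 = 0 ∧ (k : EndSpinor) s 3 = 0 := by
  have h : ‖(k : EndSpinor) s 2‖ ^ 2 + ‖(k : EndSpinor) s 3‖ ^ 2 = ‖s 2‖ ^ 2 + ‖s 3‖ ^ 2 :=
    congrArg (fun b : Vec => b.2.2.1) (hk s)
  exact norm_sq_add_norm_sq_eq_zero (by simpa [h2, h3] using h)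

theorem kernel_lower (hk : Lifts k 1) {s : Spinor} (h0 : s 0 = 0) (h1 : s 1 = 0) :
    (k : EndSpinor) s 0 = 0 ∧ (k : EndSpinor) s 1 = 0 := by
  have h : ‖(k : EndSpinor) s 0‖ ^ 2 + ‖(k : EndSpinor) s 1‖ ^ 2 = ‖s 0‖ ^ 2 + ‖s 1‖ ^ 2 :=
    congrArg (fun b : Vec => b.1) (hk s)
  exact norm_sq_add_norm_sq_eq_zero (by simpa [h0, h1] using h)

/-- The transpose of the pairing of upper and lower spinors against the vector `(0, t, 0, u)`. -/
def cliffordMap (t : ℝ) (u : Octonion) (d : Spinor) : Spinor :=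
  ![t • d 2 + u * C (d 3), C (d 2) * u - t • d 3, 0, 0]

theorem inner_cliffordMap (t : ℝ) (u : Octonion) {s d : Spinor} (s2 : s 2 = 0) (s3 : s 3 = 0)
    (d0 : d 0 = 0) (d1 : d 1 = 0) :
    ⟪s 0, cliffordMap t u d 0⟫ + ⟪s 1, cliffordMap t u d 1⟫ =
      (1 / 2) * (t * (dsquaring s d).2.1 + ⟪u, (dsquaring s d).2.2.2⟫) := by
  simp only [cliffordMap, dsquaring, s2, s3, d0, d1, Matrix.cons_val_zero, Matrix.cons_val_one,
    inner_add_right, inner_sub_right, inner_smul_right, add_zero, mul_zero,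
    inner_zero_left, inner_zero_right]
  rw [← inner_mul_right, ← inner_mul_left, real_inner_comm u, real_inner_comm u]
  ring

theorem kernel_cliffordMap (hk : Lifts k 1) (t : ℝ) (u : Octonion) {d : Spinor}
    (d0 : d 0 = 0) (d1 : d 1 = 0) :
    cliffordMap t u ((k : EndSpinor) d) = (k : EndSpinor) (cliffordMap t u d) := by
  obtain ⟨e0, e1⟩ := kernel_lower hk d0 d1
  obtain ⟨e2, e3⟩ := kernel_upper hk (s := cliffordMap t u d) rfl rfl
  set q := cliffordMap t u ((k : EndSpinor) d) - (k : EndSpinor) (cliffordMap t u d) with hq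
  have q2 : q 2 = 0 := by rw [hq, Pi.sub_apply, e2, sub_zero]; rfl
  have q3 : q 3 = 0 := by rw [hq, Pi.sub_apply, e3, sub_zero]; rfl
  set s := ((k⁻¹ : EndSpinorˣ) : EndSpinor) q with hs
  have hks : (k : EndSpinor) s = q := units_apply_inv_apply k q
  have hki : Lifts k⁻¹ 1 := by simpa using hk.inv
  obtain ⟨s2, s3⟩ := kernel_upper hki q2 q3
  have h1 := inner_cliffordMap t u q2 q3 e0 e1
  have h2 := inner_cliffordMap t u (s := s) (d := d) s2 s3 d0 d1
  rw [← hks, dsquaring_eq_of_kernel hk, ← h2, hks] at h1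
  have h3 := congrArg Prod.fst (dsquaring_eq_of_kernel hk s (cliffordMap t u d))
  simp only [dsquaring, hks] at h3
  have hz : ⟪q 0, q 0⟫ + ⟪q 1, q 1⟫ = 0 := by
    nth_rw 2 [hq]
    nth_rw 3 [hq]
    simp only [Pi.sub_apply, inner_sub_right]
    linarith
  rw [real_inner_self_eq_norm_sq, real_inner_self_eq_norm_sq] at hz
  obtain ⟨q0, q1⟩ := norm_sq_add_norm_sq_eq_zero hz
  have : q = 0 := by
    funext i; fin_cases i
    exacts [q0, q1, q2, q3]
  exact sub_eq_zero.1 this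

theorem eq_one_or_neg_one_of_lifts_one (hk : Lifts k 1) : k = 1 ∨ k = -1 := by
  let U : Octonion → Octonion → Spinor := fun x y => ![x, y, 0, 0]
  let D : Octonion → Octonion → Spinor := fun x y => ![0, 0, x, y]
  let K1 : Octonion → Octonion → Octonion := fun x y => (k : EndSpinor) (U x y) 0
  let K2 : Octonion → Octonion → Octonion := fun x y => (k : EndSpinor) (U x y) 1
  have lower : ∀ x y, (k : EndSpinor) (D x y) 2 = K1 x (-y) ∧
      (k : EndSpinor) (D x y) 3 = -K2 x (-y) := fun x y => by
    have h := kernel_cliffordMap hk 1 0 (d := D x y) rfl rfl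
    have hU : cliffordMap 1 0 (D x y) = U x (-y) := by
      funext i; fin_cases i <;> simp [cliffordMap, U, D]
    rw [hU] at h
    have a0 := congrFun h 0
    have a1 := congrFun h 1
    simp [cliffordMap] at a0 a1
    exact ⟨a0, by rw [← neg_eq_iff_eq_neg]; exact a1⟩
  have comm : ∀ u x y, K1 (-(u * C y)) (C x * u) = -(u * C (K2 x y)) ∧
      K2 (-(u * C y)) (C x * u) = C (K1 x y) * u := fun u x y => by
    have h := kernel_cliffordMap hk 0 u (d := D x (-y)) rfl rfl
    have hU : cliffordMap 0 u (D x (-y)) = U (-(u * C y)) (C x * u) := by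
      funext i; fin_cases i <;> simp [cliffordMap, U, D]
    rw [hU] at h
    have a0 := congrFun h 0
    have a1 := congrFun h 1
    simp only [cliffordMap, (lower x (-y)).1, (lower x (-y)).2, neg_neg] at a0 a1
    simp at a0 a1
    exact ⟨a0.symm, a1.symm⟩
  have hUadd : ∀ x y, U x y = U x 0 + U 0 y := fun x y => by
    funext i; fin_cases i <;> simp [U]
  have add1 : ∀ x y, K1 x y = K1 x 0 + K1 0 y := fun x y => by
    simp only [K1]; rw [hUadd x y, map_add]; rfl
  have add2 : ∀ x y, K2 x y = K2 x 0 + K2 0 y := fun x y => by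
    simp only [K2]; rw [hUadd x y, map_add]; rfl
  have r1 : ∀ x u, K2 0 (C x * u) = C (K1 x 0) * u := fun x u => by
    simpa using (comm u x 0).2
  have r2 : ∀ x u, K1 0 (C x * u) = -(u * C (K2 x 0)) := fun x u => by
    simpa using (comm u x 0).1
  have d1 : ∀ u, K2 0 u = C (K1 1 0) * u := fun u => by simpa [C_one] using r1 1 u
  have a1 : ∀ x, C (K1 x 0) = C (K1 1 0) * C x := fun x => by
    rw [← d1, ← mul_one (C x), r1, mul_one]
  have b1 : ∀ u, K1 0 u = -(u * C (K2 1 0)) := fun u => by simpa [C_one] using r2 1 u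
  have g1 : ∀ x, C (K2 x 0) = C x * C (K2 1 0) := fun x => by
    have := r2 x 1
    rw [mul_one, one_mul, b1, neg_inj] at this
    exact this.symm
  obtain ⟨r, hr⟩ := exists_real_of_mul_assoc (c := C (K1 1 0)) fun x u => by
    have := r1 (C x) u
    rwa [d1, a1 (C x), C_C] at this
  have hz : C (K2 1 0) = 0 := eq_zero_of_mul_swap fun x u => by
    have := r2 (C x) u
    rwa [b1, g1 (C x), C_C, neg_inj] at this
  have A : ∀ x, K1 x 0 = r • x := fun x => by
    rw [← C_C (K1 x 0), a1, hr, smul_one_mul, map_smul, C_C]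
  have B : ∀ y, K1 0 y = 0 := fun y => by rw [b1, hz, mul_zero, neg_zero]
  have G : ∀ x, K2 x 0 = 0 := fun x => by rw [← C_C (K2 x 0), g1, hz, mul_zero, map_zero]
  have E : ∀ y, K2 0 y = r • y := fun y => by rw [d1, hr, smul_one_mul]
  have full : (k : EndSpinor) = r • 1 := by
    ext s i
    have hs : s = U (s 0) (s 1) + D (s 2) (s 3) := by
      funext i; fin_cases i <;> simp [U, D]
    obtain ⟨u2, u3⟩ := kernel_upper hk (s := U (s 0) (s 1)) rfl rfl
    obtain ⟨l0, l1⟩ := kernel_lower hk (s := D (s 2) (s 3)) rfl rfl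
    have l2 := (lower (s 2) (s 3)).1
    have l3 := (lower (s 2) (s 3)).2
    have u0 : (k : EndSpinor) (U (s 0) (s 1)) 0 = K1 (s 0) (s 1) := rfl
    have u1 : (k : EndSpinor) (U (s 0) (s 1)) 1 = K2 (s 0) (s 1) := rfl
    rw [add1, A, B, add_zero] at l2 u0
    rw [add2, G, E, zero_add] at l3 u1
    conv_lhs => rw [hs]
    rw [map_add]
    fin_cases i <;> simp [u0, u1, u2, u3, l0, l1, l2, l3]
  have hn := congrArg Prod.fst (hk ![1, 0, 0, 0])
  rw [full] at hn
  simp [squaring, norm_smul, norm_one'] at hn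
  rcases hn with h | h
  · left; ext1; rw [full, h, one_smul]; rfl
  · right; ext1; rw [full, h, Units.val_neg, Units.val_one]; module

end Kernel

/-- The parameters with only `x, y, z, u` nonzero. -/
def baseParam (x y z : ℝ) (u : Octonion) : Spin101Param := ⟨x, y, z, u, 0, 0, 0, zero_mem_spin8⟩

theorem exp_mem_Spin10 (r : ℝ) (u : Octonion) :
    expUnit (baseParam 0 (-r) r u).toSpinor ∈ Spin10 := by
  refine Subgroup.subset_closure ⟨r, u, 0, 0, zero_mem_spin8, ?_⟩
  have h : (baseParam 0 (-r) r u).toSpinor = spin10Matrix r u 0 0 := by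
    have hR : R 0 = 0 := by ext x; exact mul_zero x
    have hL : L 0 = 0 := by ext x; exact zero_mul x
    simp [Spin101Param.toSpinor, spin10Matrix, baseParam, hR, hL]
  rw [← h]; rfl

theorem neg_one_mem_Spin10 : (-1 : EndSpinorˣ) ∈ Spin10 := by
  have h := exp_mem_Spin10 Real.pi 0
  convert h using 1
  ext1
  set N := (baseParam 0 (-1) 1 0).toSpinor with hN
  have hpi : (baseParam 0 (-Real.pi) Real.pi 0).toSpinor = Real.pi • N := by
    ext s i
    fin_cases i <;>
    simp [hN, toSpinor_apply_zero, toSpinor_apply_one, toSpinor_apply_two,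
      toSpinor_apply_three, baseParam]
  have hsq : N * N = -1 := by
    ext s i
    fin_cases i <;>
    simp [hN, mul_apply_eq_comp, toSpinor_apply_zero, toSpinor_apply_one, toSpinor_apply_two,
      toSpinor_apply_three, baseParam]
  have hcu : N * (N * N) = -N := by
    rw [hsq]; ext1 s; simp [mul_apply_eq_comp]
  change (-1 : EndSpinor) = NormedSpace.exp _
  rw [hpi, exp_smul_of_cube_eq_neg (N := N) hcu, hsq]
  simp only [Real.sin_pi, Real.cos_pi]
  module

/-- The orthogonal complement of the time axis, with coordinates `(a₁ - a₃, a₂, x)`. -/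
abbrev Space : Type := WithLp 2 (ℝ × WithLp 2 (ℝ × Octonion))

/-- The vector of `Space` with the given coordinates. -/
def spaceMk (a b : ℝ) (x : Octonion) : Space := WithLp.toLp 2 (a, WithLp.toLp 2 (b, x))

theorem inner_space (v w : Space) :
    ⟪v, w⟫ = v.fst * w.fst + v.snd.fst * w.snd.fst + ⟪v.snd.snd, w.snd.snd⟫ := by
  rw [WithLp.prod_inner_apply, WithLp.prod_inner_apply]
  have h : ∀ a b : ℝ, ⟪a, b⟫ = a * b := fun a b => by simp [mul_comm]
  rw [h, h, add_assoc]
  rfl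

theorem space_ext {v w : Space} (h1 : v.fst = w.fst) (h2 : v.snd.fst = w.snd.fst)
    (h3 : v.snd.snd = w.snd.snd) : v = w :=
  WithLp.ofLp_injective 2 (Prod.ext h1 (WithLp.ofLp_injective 2 (Prod.ext h2 h3)))

/-- The inclusion of the orthogonal complement of the time axis. -/
def spaceIncl : Space →ₗ[ℝ] Vec where
  toFun v := (v.fst / 2, v.snd.fst, -(v.fst / 2), v.snd.snd)
  map_add' v w := by
    refine Prod.ext ?_ (Prod.ext ?_ (Prod.ext ?_ ?_)) <;> simp <;> ring
  map_smul' t v := by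
    refine Prod.ext ?_ (Prod.ext ?_ (Prod.ext ?_ ?_)) <;> simp <;> ring

/-- The projection along the time axis. -/
def spaceProj : Vec →ₗ[ℝ] Space where
  toFun b := spaceMk (b.1 - b.2.2.1) b.2.1 b.2.2.2
  map_add' v w := by
    apply space_ext <;> simp [spaceMk]; ring
  map_smul' t v := by
    apply space_ext <;> simp [spaceMk]; ring

theorem spaceProj_spaceIncl (v : Space) : spaceProj (spaceIncl v) = v := by
  apply space_ext <;> simp [spaceMk, spaceProj, spaceIncl]

theorem time_add_space (b : Vec) :
    ((b.1 + b.2.2.1) / 2) • timeAxis + spaceIncl (spaceProj b) = b := by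
  refine Prod.ext ?_ (Prod.ext ?_ (Prod.ext ?_ ?_)) <;>
    simp [spaceIncl, spaceProj, spaceMk, timeAxis] <;> ring

theorem lor_spaceIncl (v w : Space) : lor (spaceIncl v) (spaceIncl w) = ⟪v, w⟫ := by
  rw [inner_space]
  simp only [lor, spaceIncl, LinearMap.coe_mk, AddHom.coe_mk]
  ring

theorem lor_timeAxis (b : Vec) : lor b timeAxis = -2 * (b.1 + b.2.2.1) := by
  simp [lor, timeAxis]

/-- A linear map of `Space`, extended by the identity of the time axis. -/
def extendSpace (A : Space →ₗ[ℝ] Space) : EndVec :=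
  LinearMap.toContinuousLinearMap (LinearMap.id + spaceIncl ∘ₗ (A - 1) ∘ₗ spaceProj)

theorem extendSpace_apply (A : Space →ₗ[ℝ] Space) (b : Vec) :
    extendSpace A b = b + spaceIncl (A (spaceProj b) - spaceProj b) := rfl

/-- Isometries of `Space`, extended by the identity of the time axis. -/
def extendIsometry : (Space ≃ₗᵢ[ℝ] Space) →* EndVecˣ :=
  MonoidHom.toHomUnits
    { toFun := fun φ => extendSpace φ.toLinearEquiv.toLinearMap
      map_one' := by
        refine ContinuousLinearMap.ext fun b => ?_
        rw [extendSpace_apply]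
        simp
      map_mul' := fun φ ψ => by
        refine ContinuousLinearMap.ext fun b => ?_
        simp only [mul_apply_eq_comp, extendSpace_apply, map_add, spaceProj_spaceIncl]
        simp only [LinearEquiv.coe_coe, LinearIsometryEquiv.coe_toLinearEquiv, map_sub,
          LinearIsometryEquiv.coe_mul, Function.comp_apply]
        abel }

theorem extendIsometry_apply (φ : Space ≃ₗᵢ[ℝ] Space) (b : Vec) :
    (extendIsometry φ : EndVec) b = b + spaceIncl (φ (spaceProj b) - spaceProj b) := rfl

/-- The transformations in `SO(10,1)` covered by `Spin(10,1)`. -/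
def spinImage : Subgroup EndVecˣ where
  carrier := {h | h ∈ SO101 ∧ ∃ g ∈ Spin101, Lifts g h}
  mul_mem' := by
    rintro _ _ ⟨m₁, g₁, n₁, k₁⟩ ⟨m₂, g₂, n₂, k₂⟩
    exact ⟨mul_mem m₁ m₂, _, mul_mem n₁ n₂, k₁.mul k₂⟩
  one_mem' := ⟨one_mem _, 1, one_mem _, lifts_one⟩
  inv_mem' := by
    rintro _ ⟨m, g, n, k⟩
    exact ⟨inv_mem m, _, inv_mem n, k.inv⟩

theorem expUnit_mem_spinImage (r : ℝ) (u : Octonion) :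
    expUnit (baseParam 0 (-r) r u).toVec ∈ spinImage := by
  refine ⟨by simpa using expUnit_toVec_mem (baseParam 0 (-r) r u) 1, _,
    Subgroup.subset_closure (Or.inl (exp_mem_Spin10 r u)), lifts_exp _⟩

/-- The coordinate vector of `a₂`. -/
def axis : Space := spaceMk 0 1 0

theorem inner_axis (w : Space) : ⟪axis, w⟫ = w.snd.fst := by
  rw [inner_space]; simp [axis, spaceMk]

theorem norm_axis : ‖axis‖ = 1 := by
  rw [← sq_eq_sq₀ (norm_nonneg _) zero_le_one, ← real_inner_self_eq_norm_sq, inner_axis]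
  simp [axis, spaceMk]

/-- The reflection in the hyperplane orthogonal to `v`. -/
abbrev hyperplaneReflection (v : Space) : Space ≃ₗᵢ[ℝ] Space :=
  Submodule.reflection (ℝ ∙ v)ᗮ

theorem hyperplaneReflection_apply {v : Space} (hv : ‖v‖ = 1) (w : Space) :
    hyperplaneReflection v w = w - (2 * ⟪v, w⟫) • v := by
  rw [hyperplaneReflection, Submodule.reflection_orthogonal_apply,
    Submodule.reflection_singleton_apply]
  simp [hv]
  module

theorem hyperplaneReflection_smul {t : ℝ} (ht : t ≠ 0) (v : Space) :
    hyperplaneReflection (t • v) = hyperplaneReflection v := by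
  have h : (ℝ ∙ (t • v)) = ℝ ∙ v := Submodule.span_singleton_smul_eq (IsUnit.mk0 t ht) v
  simp only [hyperplaneReflection, h]

/-- The generator of the rotations in the oriented plane spanned by `f` and `axis`. -/
def planeGenerator (f : Space) : Space →ₗ[ℝ] Space where
  toFun w := ⟪f, w⟫ • axis - ⟪axis, w⟫ • f
  map_add' v w := by simp only [inner_add_right]; module
  map_smul' t w := by simp only [inner_smul_right, RingHom.id_apply]; module

theorem planeGenerator_apply (f w : Space) :
    planeGenerator f w = ⟪f, w⟫ • axis - ⟪axis, w⟫ • f := rfl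

theorem exp_rotation {f : Space} (hf : ‖f‖ = 1) (hfe : ⟪axis, f⟫ = 0) (t : ℝ) :
    expUnit (baseParam 0 (-(t * f.fst)) (t * f.fst) (t • C f.snd.snd)).toVec =
      extendIsometry (hyperplaneReflection (Real.cos t • axis - Real.sin t • f) *
        hyperplaneReflection axis) := by
  let N : EndVec := LinearMap.toContinuousLinearMap (spaceIncl ∘ₗ planeGenerator f ∘ₗ spaceProj)
  have hN : ∀ b, N b = spaceIncl (planeGenerator f (spaceProj b)) := fun b => rfl
  have hee : ⟪axis, axis⟫ = 1 := by rw [real_inner_self_eq_norm_sq, norm_axis, one_pow]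
  have hff : ⟪f, f⟫ = 1 := by rw [real_inner_self_eq_norm_sq, hf, one_pow]
  have hef : ⟪f, axis⟫ = 0 := by rw [real_inner_comm, hfe]
  have hsq : ∀ w, planeGenerator f (planeGenerator f w) = -(⟪f, w⟫ • f + ⟪axis, w⟫ • axis) :=
    fun w => by
      simp only [planeGenerator_apply, inner_sub_right, inner_smul_right, hee, hff, hef, hfe]
      module
  have hcube : N * (N * N) = -N := by
    refine ContinuousLinearMap.ext fun b => ?_
    simp only [mul_apply_eq_comp, hN, spaceProj_spaceIncl, neg_apply, hsq]
    rw [← map_neg]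
    congr 1
    simp only [planeGenerator_apply, inner_neg_right, inner_add_right, inner_smul_right, hee, hff,
      hef, hfe]
    module
  have hP : (baseParam 0 (-(t * f.fst)) (t * f.fst) (t • C f.snd.snd)).toVec = (2 * t) • N := by
    refine ContinuousLinearMap.ext fun b => ?_
    have h0 : f.snd.fst = 0 := by rw [← inner_axis, hfe]
    have hfb : ⟪f, spaceProj b⟫ = f.fst * (b.1 - b.2.2.1) + ⟪f.snd.snd, b.2.2.2⟫ := by
      rw [inner_space, h0]; simp [spaceProj, spaceMk]
    have heb : ⟪axis, spaceProj b⟫ = b.2.1 := inner_axis _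
    rw [toVec_apply, smul_apply, hN, planeGenerator_apply, hfb, heb]
    refine Prod.ext ?_ (Prod.ext ?_ (Prod.ext ?_ ?_)) <;>
      simp [baseParam, spaceIncl, axis, spaceMk, h0, C_C, inner_smul_left]
    · ring
    · ring
    · ring
    · module
  have hv : ‖Real.cos t • axis - Real.sin t • f‖ = 1 := by
    rw [← sq_eq_sq₀ (norm_nonneg _) zero_le_one, ← real_inner_self_eq_norm_sq]
    simp only [inner_sub_left, inner_sub_right, real_inner_smul_left, real_inner_smul_right, hee,
      hff, hef, hfe]
    linear_combination Real.sin_sq_add_cos_sq t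
  ext1
  refine ContinuousLinearMap.ext fun b => ?_
  change (NormedSpace.exp (baseParam 0 _ _ _).toVec : EndVec) b = _
  rw [hP, exp_smul_of_cube_eq_neg hcube, extendIsometry_apply]
  simp only [add_apply, one_apply_eq_self, smul_apply, mul_apply_eq_comp, hN, spaceProj_spaceIncl,
    hsq]
  rw [add_assoc, ← map_smul spaceIncl, ← map_smul spaceIncl, ← map_add]
  congr 2
  rw [LinearIsometryEquiv.coe_mul, Function.comp_apply, hyperplaneReflection_apply norm_axis,
    hyperplaneReflection_apply hv, planeGenerator_apply]
  simp only [inner_sub_left, inner_sub_right, real_inner_smul_left, real_inner_smul_right, hee,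
    hef, Real.sin_two_mul, Real.cos_two_mul, Real.cos_sq']
  match_scalars
  · linear_combination (-2 * ⟪axis, spaceProj b⟫) * Real.sin_sq_add_cos_sq t
  · ring
  · ring

theorem reflection_mul_reflection_mem {v : Space} (hv : v ≠ 0) :
    extendIsometry (hyperplaneReflection v * hyperplaneReflection axis) ∈ spinImage := by
  wlog hn : ‖v‖ = 1 generalizing v
  · have h0 : ‖v‖⁻¹ ≠ 0 := inv_ne_zero (norm_ne_zero_iff.2 hv)
    have h := this (v := ‖v‖⁻¹ • v) (smul_ne_zero h0 hv) (by
      rw [norm_smul, norm_inv, norm_norm, inv_mul_cancel₀ (norm_ne_zero_iff.2 hv)])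
    rwa [hyperplaneReflection_smul h0] at h
  have hee : ⟪axis, axis⟫ = 1 := by rw [real_inner_self_eq_norm_sq, norm_axis, one_pow]
  set c := ⟪axis, v⟫ with hc
  set w := c • axis - v with hw
  have hww : ‖w‖ ^ 2 = 1 - c ^ 2 := by
    rw [hw, ← real_inner_self_eq_norm_sq]
    simp only [inner_sub_left, inner_sub_right, real_inner_smul_left, real_inner_smul_right, hee,
      real_inner_comm axis v, ← hc, real_inner_self_eq_norm_sq v, hn]
    ring
  have hew : ⟪axis, w⟫ = 0 := by
    rw [hw, inner_sub_right, inner_smul_right, hee, ← hc]; ring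
  by_cases hz : w = 0
  · have hvc : v = c • axis := (sub_eq_zero.1 hz).symm
    have hc0 : c ≠ 0 := by
      rintro h; rw [h, zero_smul] at hvc; exact hv hvc
    rw [hvc, hyperplaneReflection_smul hc0]
    have : hyperplaneReflection axis * hyperplaneReflection axis = 1 :=
      Submodule.reflection_mul_reflection _
    rw [this, map_one]
    exact one_mem _
  · have hw0 : ‖w‖ ≠ 0 := norm_ne_zero_iff.2 hz
    have hcb : -1 ≤ c ∧ c ≤ 1 := abs_le.1 (sq_le_one_iff_abs_le_one c |>.1 (by
      have := sq_nonneg ‖w‖; linarith))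
    have h := exp_rotation (f := ‖w‖⁻¹ • w) (by
      rw [norm_smul, norm_inv, norm_norm, inv_mul_cancel₀ hw0])
      (by rw [inner_smul_right, hew, mul_zero]) (Real.arccos c)
    rw [Real.cos_arccos hcb.1 hcb.2, Real.sin_arccos, ← hww, Real.sqrt_sq (norm_nonneg _),
      smul_smul, mul_inv_cancel₀ hw0, one_smul, hw, sub_sub_cancel] at h
    rw [← h]
    exact expUnit_mem_spinImage _ _

theorem mem_spinImage_or (φ : Space ≃ₗᵢ[ℝ] Space) : extendIsometry φ ∈ spinImage ∨
    extendIsometry (φ * hyperplaneReflection axis) ∈ spinImage := by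
  have hss : ∀ v, hyperplaneReflection v * hyperplaneReflection v = 1 := fun v =>
    Submodule.reflection_mul_reflection _
  have step : ∀ (φ : Space ≃ₗᵢ[ℝ] Space) (v : Space), (extendIsometry φ ∈ spinImage ∨
      extendIsometry (φ * hyperplaneReflection axis) ∈ spinImage) →
      (extendIsometry (φ * hyperplaneReflection v) ∈ spinImage ∨
      extendIsometry (φ * hyperplaneReflection v * hyperplaneReflection axis) ∈ spinImage) := by
    intro φ v h
    rcases eq_or_ne v 0 with rfl | hv
    · have h1 : hyperplaneReflection 0 = 1 := by
        ext1 x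
        exact Submodule.reflection_mem_subspace_eq_self (by simp)
      rwa [h1, mul_one]
    have hr := reflection_mul_reflection_mem hv
    rcases h with h | h
    · right
      rw [mul_assoc, map_mul]
      exact mul_mem h hr
    · left
      have h2 := mul_mem h (inv_mem hr)
      rw [← map_inv, ← map_mul, mul_inv_rev, inv_eq_of_mul_eq_one_left (hss axis),
        inv_eq_of_mul_eq_one_left (hss v), mul_assoc, ← mul_assoc (hyperplaneReflection axis),
        hss, one_mul] at h2
      exact h2
  have hφ : φ ∈ Subgroup.closure (Set.range hyperplaneReflection) := by
    have h := LinearIsometryEquiv.reflections_generate (F := Space)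
    rw [h]; exact Subgroup.mem_top _
  induction hφ using Subgroup.closure_induction_right with
  | one => left; rw [map_one]; exact one_mem _
  | mul_right x hx y hy ih => obtain ⟨v, rfl⟩ := hy; exact step x v ih
  | mul_inv_cancel x hx y hy ih =>
    obtain ⟨v, rfl⟩ := hy
    rw [inv_eq_of_mul_eq_one_left (hss v)]
    exact step x v ih

theorem det_reflection_axis : LinearMap.det
    (((extendIsometry (hyperplaneReflection axis) : EndVecˣ) : EndVec) : Vec →ₗ[ℝ] Vec) = -1 := by
  have h : (((extendIsometry (hyperplaneReflection axis) : EndVecˣ) : EndVec) : Vec →ₗ[ℝ] Vec) =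
      LinearMap.prodMap LinearMap.id (LinearMap.prodMap (-LinearMap.id) LinearMap.id) := by
    refine LinearMap.ext fun b => ?_
    rw [ContinuousLinearMap.coe_coe, extendIsometry_apply, hyperplaneReflection_apply norm_axis,
      inner_axis]
    refine Prod.ext ?_ (Prod.ext ?_ (Prod.ext ?_ ?_)) <;>
      simp [spaceIncl, spaceProj, spaceMk, axis]
    ring
  rw [h, LinearMap.det_prodMap, LinearMap.det_prodMap]
  simp [LinearMap.det_ring]

/-! ### Surjectivity -/

theorem extendIsometry_timeAxis (φ : Space ≃ₗᵢ[ℝ] Space) :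
    (extendIsometry φ : EndVec) timeAxis = timeAxis := by
  have h : spaceProj timeAxis = 0 := by
    apply space_ext <;> simp [spaceProj, spaceMk, timeAxis]
  rw [extendIsometry_apply, h]
  simp

theorem mem_spinImage_of_fix {h : EndVecˣ} (hh : h ∈ SO101)
    (hT : (h : EndVec) timeAxis = timeAxis) : h ∈ spinImage := by
  have key : ∀ w, spaceIncl (spaceProj ((h : EndVec) (spaceIncl w))) =
      (h : EndVec) (spaceIncl w) := fun w => by
    have h1 := hh.2 (spaceIncl w) timeAxis
    rw [hT, lor_timeAxis, lor_timeAxis] at h1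
    have h2 : (spaceIncl w).1 + (spaceIncl w).2.2.1 = 0 := by simp [spaceIncl]
    have h3 := time_add_space ((h : EndVec) (spaceIncl w))
    have h4 : (((h : EndVec) (spaceIncl w)).1 + ((h : EndVec) (spaceIncl w)).2.2.1) = 0 := by
      rw [h2] at h1; linarith
    rwa [h4, zero_div, zero_smul, zero_add] at h3
  let A : Space →ₗᵢ[ℝ] Space :=
    { toLinearMap := spaceProj ∘ₗ ((h : EndVec) : Vec →ₗ[ℝ] Vec) ∘ₗ spaceIncl
      norm_map' := fun w => by
        rw [← sq_eq_sq₀ (norm_nonneg _) (norm_nonneg _), ← real_inner_self_eq_norm_sq,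
          ← real_inner_self_eq_norm_sq, ← lor_spaceIncl, ← lor_spaceIncl]
        simp only [LinearMap.comp_apply, ContinuousLinearMap.coe_coe, key]
        exact hh.2 _ _ }
  let φ : Space ≃ₗᵢ[ℝ] Space := A.toLinearIsometryEquiv rfl
  have hφ : extendIsometry φ = h := by
    ext1
    refine ContinuousLinearMap.ext fun b => ?_
    have h1 : φ (spaceProj b) = spaceProj ((h : EndVec) (spaceIncl (spaceProj b))) := rfl
    rw [extendIsometry_apply, h1, map_sub, key]
    have h2 := congrArg (h : EndVec) (time_add_space b)
    rw [map_add, map_smul, hT] at h2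
    rw [← h2]
    nth_rw 1 [← time_add_space b]
    abel
  rcases mem_spinImage_or φ with h1 | h1
  · rwa [hφ] at h1
  · exfalso
    have h2 := h1.1.1
    rw [map_mul, hφ, Units.val_mul, ContinuousLinearMap.toLinearMap_mul, map_mul, hh.1,
      det_reflection_axis] at h2
    norm_num at h2

theorem exp_boost (t : ℝ) : NormedSpace.exp (baseParam t 0 0 0).toSpinor = ofBlocks
    !![Real.exp t • 1, 0, 0, 0;
       0, Real.exp t • 1, 0, 0;
       0, 0, (Real.exp t)⁻¹ • 1, 0;
       0, 0, 0, (Real.exp t)⁻¹ • 1] := by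
  set N := (baseParam 1 0 0 0).toSpinor with hN
  have hsq : N * N = 1 := by
    refine ContinuousLinearMap.ext fun s => funext fun i => ?_
    fin_cases i <;>
    simp [hN, mul_apply_eq_comp, toSpinor_apply_zero, toSpinor_apply_one, toSpinor_apply_two,
      toSpinor_apply_three, baseParam]
  have ht : (baseParam t 0 0 0).toSpinor = t • N := by
    refine ContinuousLinearMap.ext fun s => funext fun i => ?_
    fin_cases i <;>
    simp [hN, toSpinor_apply_zero, toSpinor_apply_one, toSpinor_apply_two,
      toSpinor_apply_three, baseParam]
  rw [ht, exp_smul_of_sq_eq_one hsq]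
  refine ContinuousLinearMap.ext fun s => funext fun i => ?_
  rw [ofBlocks_apply, ← Real.exp_neg, ← Real.cosh_sub_sinh t, ← Real.cosh_add_sinh t]
  fin_cases i <;>
  simp [hN, toSpinor_apply_zero, toSpinor_apply_one, toSpinor_apply_two,
      toSpinor_apply_three, baseParam, add_smul, sub_eq_add_neg, -Real.cosh_add_sinh]

theorem exp_boost_mem (t : ℝ) : expUnit (baseParam t 0 0 0).toSpinor ∈ Spin101 :=
  Subgroup.subset_closure (Or.inr ⟨Real.exp t, Real.exp_pos t, exp_boost t⟩)

theorem exp_boost_mem_spinImage (t : ℝ) : expUnit (baseParam t 0 0 0).toVec ∈ spinImage :=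
  ⟨by simpa using expUnit_toVec_mem (baseParam t 0 0 0) 1, _, exp_boost_mem t, lifts_exp _⟩

theorem exp_boost_timeAxis (t : ℝ) :
    (expUnit (baseParam t 0 0 0).toVec : EndVec) timeAxis =
      (Real.exp t ^ 2, 0, (Real.exp t)⁻¹ ^ 2, 0) := by
  have h1 := lifts_exp (baseParam t 0 0 0) ![1, 0, 0, 0]
  have h2 := lifts_exp (baseParam t 0 0 0) ![0, 0, 1, 0]
  have hT : timeAxis = squaring ![1, 0, 0, 0] + squaring ![0, 0, 1, 0] := by
    simp [timeAxis, squaring, norm_one']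
  rw [hT, map_add, ← h1, ← h2]
  have he : ((expUnit (baseParam t 0 0 0).toSpinor : EndSpinorˣ) : EndSpinor) = _ := exp_boost t
  rw [he]
  simp [squaring, ofBlocks_apply, norm_smul, norm_one']

theorem exists_mem_spinImage_apply_timeAxis {b : Vec} (hb : lor b b = -4)
    (hf : lor b timeAxis < 0) : ∃ h ∈ spinImage, (h : EndVec) timeAxis = b := by
  set w := spaceProj b with hw
  set τ := (b.1 + b.2.2.1) / 2 with hτ
  have hb' := time_add_space b
  rw [← hτ, ← hw] at hb'
  have hτ0 : 0 < τ := by rw [lor_timeAxis] at hf; rw [hτ]; linarith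
  have hn : ‖w‖ ^ 2 = 4 * τ ^ 2 - 4 := by
    have h1 : ‖w‖ ^ 2 = (b.1 - b.2.2.1) ^ 2 + b.2.1 ^ 2 + ⟪b.2.2.2, b.2.2.2⟫ := by
      rw [← real_inner_self_eq_norm_sq, inner_space, sq, sq]; rfl
    rw [lor] at hb
    rw [h1, hτ]
    linear_combination hb
  let e₀ : Space := spaceMk 1 0 0
  have he₀ : ‖e₀‖ = 1 := by
    rw [← sq_eq_sq₀ (norm_nonneg _) zero_le_one, ← real_inner_self_eq_norm_sq, inner_space]
    simp [e₀, spaceMk]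
  obtain ⟨φ, hφ, hφw⟩ : ∃ φ : Space ≃ₗᵢ[ℝ] Space, extendIsometry φ ∈ spinImage ∧
      φ (‖w‖ • e₀) = w := by
    by_cases hz : ‖w‖ • e₀ - w = 0
    · exact ⟨1, by rw [map_one]; exact one_mem _, sub_eq_zero.1 hz⟩
    · refine ⟨_, reflection_mul_reflection_mem hz, ?_⟩
      have h1 : ⟪axis, ‖w‖ • e₀⟫ = 0 := by
        rw [inner_axis]; simp [e₀, spaceMk]
      rw [LinearIsometryEquiv.coe_mul, Function.comp_apply, hyperplaneReflection_apply norm_axis,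
        h1, mul_zero, zero_smul, sub_zero]
      exact Submodule.reflection_sub (by rw [norm_smul, norm_norm, he₀, mul_one])
  have hpos : 0 < τ + ‖w‖ / 2 := by positivity
  have hinv : (τ + ‖w‖ / 2)⁻¹ = τ - ‖w‖ / 2 := by
    refine inv_eq_of_mul_eq_one_right ?_
    linear_combination -hn / 4
  refine ⟨_, mul_mem hφ (exp_boost_mem_spinImage (Real.log (τ + ‖w‖ / 2) / 2)), ?_⟩
  rw [Units.val_mul, mul_apply_eq_comp, exp_boost_timeAxis, inv_pow, ← Real.exp_nat_mul]
  have hl : ((2 : ℕ) : ℝ) * (Real.log (τ + ‖w‖ / 2) / 2) = Real.log (τ + ‖w‖ / 2) := by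
    push_cast; ring
  rw [hl, Real.exp_log hpos, hinv]
  have hv : ((τ + ‖w‖ / 2, 0, τ - ‖w‖ / 2, 0) : Vec) = τ • timeAxis + spaceIncl (‖w‖ • e₀) := by
    refine Prod.ext ?_ (Prod.ext ?_ (Prod.ext ?_ ?_)) <;>
      simp [timeAxis, spaceIncl, e₀, spaceMk] <;> ring
  rw [hv, map_add, map_smul, extendIsometry_timeAxis, extendIsometry_apply, spaceProj_spaceIncl,
    hφw, ← map_add, add_sub_cancel, hb']

theorem mem_spinImage {h : EndVecˣ} (hh : h ∈ SO101)
    (hf : lor ((h : EndVec) timeAxis) timeAxis < 0) : h ∈ spinImage := by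
  have hb : lor ((h : EndVec) timeAxis) ((h : EndVec) timeAxis) = -4 := by
    rw [hh.2, lor_timeAxis]; norm_num [timeAxis]
  obtain ⟨m, hm, hmT⟩ := exists_mem_spinImage_apply_timeAxis hb hf
  have h1 : m⁻¹ * h ∈ spinImage := mem_spinImage_of_fix (mul_mem (inv_mem hm.1) hh) (by
    rw [Units.val_mul, mul_apply_eq_comp, ← hmT, units_inv_apply_apply])
  simpa using mul_mem hm h1

theorem lor_timeAxis_ne_zero {h : EndVecˣ} (hh : h ∈ SO101) :
    lor ((h : EndVec) timeAxis) timeAxis ≠ 0 := by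
  have hb := hh.2 timeAxis timeAxis
  set b := (h : EndVec) timeAxis
  intro h0
  rw [lor_timeAxis] at h0 hb
  have h1 : b.2.2.1 = -b.1 := by linarith
  have h2 := real_inner_self_nonneg (x := b.2.2.2)
  simp only [lor, h1, timeAxis] at hb
  nlinarith [sq_nonneg b.1, sq_nonneg b.2.1]

theorem lor_timeAxis_neg_of_mem {h : EndVecˣ} (hh : h ∈ SOUp101) :
    lor ((h : EndVec) timeAxis) timeAxis < 0 := by
  obtain ⟨h, hc, rfl⟩ := hh
  let f : SO101 → ℝ := fun h => lor (((h : EndVecˣ) : EndVec) timeAxis) timeAxis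
  have hf : Continuous f := by
    have hv : Continuous fun h : SO101 => ((h : EndVecˣ) : EndVec) :=
      Units.continuous_val.comp continuous_subtype_val
    exact continuous_lor.comp ((hv.clm_apply continuous_const).prodMk continuous_const)
  by_contra hn
  have hpc : IsPreconnected (connectedComponent (1 : SO101)) := isPreconnected_connectedComponent
  have h1 : f 1 ≤ 0 := by
    have : f 1 = lor timeAxis timeAxis := rfl
    rw [this, lor_timeAxis]; norm_num [timeAxis]
  obtain ⟨m, -, hm⟩ := hpc.intermediate_value mem_connectedComponent hc hf.continuousOn
    ⟨h1, not_lt.1 hn⟩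
  exact lor_timeAxis_ne_zero m.2 hm

theorem exists_lift {h : EndVecˣ} (hh : h ∈ SOUp101) : ∃ g ∈ Spin101, Lifts g h :=
  (mem_spinImage (SOUp101_le hh) (lor_timeAxis_neg_of_mem hh)).2

/-! ### `Spin(10,1)` is the group of all lifts -/

theorem neg_one_mem_Spin101 : (-1 : EndSpinorˣ) ∈ Spin101 :=
  Subgroup.subset_closure (Or.inl neg_one_mem_Spin10)

theorem spin10Matrix_eq (r : ℝ) (u v : Octonion) {a : EndO × EndO × EndO} (ha : a ∈ spin8) :
    spin10Matrix r u v a = Spin101Param.toSpinor ⟨0, -r, r, u, -v, v, a, ha⟩ := by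
  have hR : R (-v) = -R v := by ext x; exact mul_neg x v
  have hL : L (-v) = -L v := by ext x; exact neg_mul v x
  have h1 : C * R (-v) = -(C * R v) := by rw [hR]; ext x; simp [mul_apply_eq_comp]
  have h2 : C * L (-v) = -(C * L v) := by rw [hL]; ext x; simp [mul_apply_eq_comp]
  simp [Spin101Param.toSpinor, spin10Matrix, h1, h2]

/-- `Spin(10,1)` is generated by exponentials of elements of `𝔰𝔭𝔦𝔫(10,1)`. -/
theorem Spin101_induction {p : EndSpinorˣ → Prop} {g : EndSpinorˣ} (hg : g ∈ Spin101)
    (exp : ∀ P : Spin101Param, expUnit P.toSpinor ∈ Spin101 → p (expUnit P.toSpinor))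
    (one : p 1) (mul : ∀ g ∈ Spin101, ∀ h ∈ Spin101, p g → p h → p (g * h))
    (inv : ∀ g ∈ Spin101, p g → p g⁻¹) : p g := by
  induction hg using Subgroup.closure_induction with
  | mem x hx =>
    rcases hx with hx | ⟨t, ht, hx⟩
    · have hle : Spin10 ≤ Spin101 := fun y hy => Subgroup.subset_closure (Or.inl hy)
      change x ∈ Spin10 at hx
      induction hx using Subgroup.closure_induction with
      | mem x hx =>
        have hm : x ∈ Spin10 := Subgroup.subset_closure hx
        obtain ⟨r, u, v, a, ha, hx⟩ := hx
        have : x = expUnit (Spin101Param.toSpinor ⟨0, -r, r, u, -v, v, a, ha⟩) :=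
          Units.ext (by rw [hx, spin10Matrix_eq r u v ha]; rfl)
        rw [this] at hm ⊢
        exact exp _ (hle hm)
      | one => exact one
      | mul x y hx hy px py => exact mul x (hle hx) y (hle hy) px py
      | inv x hx px => exact inv x (hle hx) px
    · have : x = expUnit (baseParam (Real.log t) 0 0 0).toSpinor :=
        Units.ext (by
          have h := exp_boost (Real.log t)
          rw [Real.exp_log ht] at h
          exact hx.trans h.symm)
      rw [this]
      exact exp _ (exp_boost_mem _)
  | one => exact one
  | mul x y hx hy px py => exact mul x hx y hy px py
  | inv x hx px => exact inv x hx px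

theorem Spin101_eq_liftGroup : Spin101 = liftGroup := by
  apply le_antisymm
  · intro g hg
    refine Spin101_induction (p := fun g => g ∈ liftGroup) hg
      (fun P _ => ⟨_, expUnit_toVec_mem_SOUp101 P, lifts_exp P⟩) (one_mem _)
      (fun _ _ _ _ => mul_mem) (fun _ _ => inv_mem)
  · rintro g ⟨h, hh, k⟩
    obtain ⟨g', hg', k'⟩ := exists_lift hh
    have h1 : Lifts (g * g'⁻¹) 1 := by simpa using k.mul k'.inv
    have h2 : g * g'⁻¹ ∈ Spin101 := by
      rcases eq_one_or_neg_one_of_lifts_one h1 with h | h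
      · rw [h]; exact one_mem _
      · rw [h]; exact neg_one_mem_Spin101
    simpa using mul_mem h2 hg'

/-- The covering homomorphism `Spin(10,1) → SO↑(10,1)`. -/
def spinHom : Spin101 →* SOUp101 := liftHom.comp (Subgroup.inclusion Spin101_eq_liftGroup.le)

theorem lifts_spinHom (g : Spin101) : Lifts g (spinHom g) :=
  lifts_liftHom (Subgroup.inclusion Spin101_eq_liftGroup.le g)

theorem spinHom_eq {g : Spin101} {h : EndVecˣ} (k : Lifts g h) : (spinHom g : EndVecˣ) = h :=
  (lifts_spinHom g).unique k

theorem continuous_spinHom : Continuous spinHom :=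
  continuous_liftHom.comp (continuous_subtype_val.subtype_mk _)

theorem expUnit_toSpinor_mem (P : Spin101Param) : expUnit P.toSpinor ∈ Spin101 := by
  rw [Spin101_eq_liftGroup]
  exact ⟨_, expUnit_toVec_mem_SOUp101 P, lifts_exp P⟩

theorem inducesOnLieAlgebras_spinHom : InducesOnLieAlgebras spinHom := by
  refine ⟨continuous_spinHom, fun P => ⟨⟨_, expUnit_toSpinor_mem P⟩, rfl, ?_⟩⟩
  exact congrArg Units.val (spinHom_eq (g := ⟨_, expUnit_toSpinor_mem P⟩) (lifts_exp P))

theorem InducesOnLieAlgebras.eq {ρ₁ ρ₂ : Spin101 →* SOUp101} (h₁ : InducesOnLieAlgebras ρ₁)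
    (h₂ : InducesOnLieAlgebras ρ₂) : ρ₁ = ρ₂ := by
  have key : ∀ g : EndSpinorˣ, g ∈ Spin101 → ∀ hg : g ∈ Spin101, ρ₁ ⟨g, hg⟩ = ρ₂ ⟨g, hg⟩ := by
    intro g hg
    refine Spin101_induction (p := fun g => ∀ hg : g ∈ Spin101, ρ₁ ⟨g, hg⟩ = ρ₂ ⟨g, hg⟩) hg
      ?_ ?_ ?_ ?_
    · intro P _ hP
      obtain ⟨g₁, e₁, f₁⟩ := h₁.2 P
      obtain ⟨g₂, e₂, f₂⟩ := h₂.2 P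
      have k₁ : g₁ = ⟨expUnit P.toSpinor, hP⟩ := Subtype.ext (Units.ext e₁)
      have k₂ : g₂ = ⟨expUnit P.toSpinor, hP⟩ := Subtype.ext (Units.ext e₂)
      rw [← k₁]
      have : g₁ = g₂ := k₁.trans k₂.symm
      refine Subtype.ext (Units.ext ?_)
      rw [f₁, this, f₂]
    · intro h1
      have : (⟨1, h1⟩ : Spin101) = 1 := rfl
      rw [this, map_one, map_one]
    · intro g mg h mh pg ph m
      have : (⟨g * h, m⟩ : Spin101) = ⟨g, mg⟩ * ⟨h, mh⟩ := rfl
      rw [this, map_mul, map_mul, pg, ph]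
    · intro g mg pg m
      have : (⟨g⁻¹, m⟩ : Spin101) = ⟨g, mg⟩⁻¹ := rfl
      rw [this, map_inv, map_inv, pg]
  ext1 g
  exact key g g.2 g.2

theorem spinHom_surjective : Function.Surjective spinHom := fun h => by
  obtain ⟨g, hg, k⟩ := exists_lift h.2
  exact ⟨⟨g, hg⟩, Subtype.ext (spinHom_eq (g := ⟨g, hg⟩) k)⟩

/-- The nontrivial element of the kernel. -/
def negOne : Spin101 := ⟨-1, neg_one_mem_Spin101⟩

theorem spinHom_eq_one_iff (g : Spin101) : spinHom g = 1 ↔ g = 1 ∨ g = negOne := by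
  constructor
  · intro h
    have k := lifts_spinHom g
    rw [h] at k
    rcases eq_one_or_neg_one_of_lifts_one k with h | h
    · exact Or.inl (Subtype.ext h)
    · exact Or.inr (Subtype.ext h)
  · rintro (rfl | rfl)
    · exact map_one _
    · refine Subtype.ext (spinHom_eq fun s => ?_)
      have h : ((negOne : EndSpinorˣ) : EndSpinor) s = -s := by simp [negOne]
      rw [h]
      simp [squaring]

theorem negOne_ne_one : negOne ≠ 1 := fun h => by
  have h1 := congrArg (fun g : Spin101 => ((g : EndSpinorˣ) : EndSpinor) (fun _ => 1) 0) h
  have h2 : -(1 : Octonion) = 1 := by simpa [negOne] using h1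
  have h3 : (1 : Octonion) ≠ 0 := by rw [← norm_ne_zero_iff, norm_one']; exact one_ne_zero
  have h4 : (2 : ℝ) • (1 : Octonion) = 0 := by
    rw [two_smul]; nth_rw 1 [← h2]; exact neg_add_cancel 1
  exact h3 ((smul_eq_zero.1 h4).resolve_left two_ne_zero)

theorem preimage_spinHom (w : SOUp101) : (spinHom ⁻¹' {w}).ncard = 2 := by
  obtain ⟨g, rfl⟩ := spinHom_surjective w
  have h : spinHom ⁻¹' {spinHom g} = {g, negOne * g} := by
    ext x
    rw [Set.mem_preimage, Set.mem_singleton_iff, ← mul_inv_eq_one, ← map_inv, ← map_mul,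
      spinHom_eq_one_iff, mul_inv_eq_one, mul_inv_eq_iff_eq_mul]
    rfl
  rw [h, Set.ncard_pair]
  intro h
  exact negOne_ne_one (mul_eq_right.1 h.symm)

/-! ### The covering property -/

section Topology

variable {E : Type*} [NormedAddCommGroup E] [NormedSpace ℝ E] [FiniteDimensional ℝ E]

instance : LocallyCompactSpace (E →L[ℝ] E)ˣ :=
  have : ProperSpace (E →L[ℝ] E) := FiniteDimensional.proper ℝ _
  have : CompleteSpace E := FiniteDimensional.complete ℝ E
  Units.isOpenEmbedding_val.locallyCompactSpace

instance : SecondCountableTopology (E →L[ℝ] E)ˣ :=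
  have : ProperSpace (E →L[ℝ] E) := FiniteDimensional.proper ℝ _
  have : CompleteSpace E := FiniteDimensional.complete ℝ E
  Units.isOpenEmbedding_val.isInducing.secondCountableTopology

end Topology

theorem isClosed_SO101 : IsClosed (SO101 : Set EndVecˣ) := by
  have hv : Continuous fun g : EndVecˣ => (g : EndVec) := Units.continuous_val
  have h : (SO101 : Set EndVecˣ) = {g : EndVecˣ | ContinuousLinearMap.det (g : EndVec) = 1} ∩
      ⋂ a : Vec, ⋂ b : Vec, {g : EndVecˣ | lor ((g : EndVec) a) ((g : EndVec) b) = lor a b} := by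
    ext g
    simp only [Set.mem_inter_iff, Set.mem_iInter, Set.mem_ofPred_eq]
    rfl
  rw [h]
  refine (isClosed_eq (ContinuousLinearMap.continuous_det.comp hv) continuous_const).inter
    (isClosed_iInter fun a => isClosed_iInter fun b => isClosed_eq ?_ continuous_const)
  exact continuous_lor.comp ((hv.clm_apply continuous_const).prodMk (hv.clm_apply continuous_const))

theorem isClosed_SOUp101 : IsClosed (SOUp101 : Set EndVecˣ) := by
  rw [SOUp101, Subgroup.coe_map]
  exact isClosed_SO101.isClosedMap_subtype_val _ isClosed_connectedComponent

instance : LocallyCompactSpace SOUp101 :=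
  isClosed_SOUp101.isClosedEmbedding_subtypeVal.locallyCompactSpace

theorem isClosed_lifts : IsClosed {p : EndSpinorˣ × EndVecˣ | p.2 ∈ SOUp101 ∧ Lifts p.1 p.2} := by
  have hg : Continuous fun p : EndSpinorˣ × EndVecˣ => (p.1 : EndSpinor) :=
    Units.continuous_val.comp continuous_fst
  have hh : Continuous fun p : EndSpinorˣ × EndVecˣ => (p.2 : EndVec) :=
    Units.continuous_val.comp continuous_snd
  have h : {p : EndSpinorˣ × EndVecˣ | Lifts p.1 p.2} =
      ⋂ s : Spinor, {p | squaring ((p.1 : EndSpinor) s) = (p.2 : EndVec) (squaring s)} := by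
    ext p; simp [Lifts]
  have hc : IsClosed {p : EndSpinorˣ × EndVecˣ | Lifts p.1 p.2} := by
    rw [h]
    exact isClosed_iInter fun s => isClosed_eq
      (continuous_squaring.comp (hg.clm_apply continuous_const)) (hh.clm_apply continuous_const)
  exact (isClosed_SOUp101.preimage continuous_snd).inter hc

instance : SigmaCompactSpace Spin101 := by
  have h : (Spin101 : Set EndSpinorˣ) =
      Prod.fst '' {p : EndSpinorˣ × EndVecˣ | p.2 ∈ SOUp101 ∧ Lifts p.1 p.2} := by
    rw [Spin101_eq_liftGroup]
    ext g
    constructor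
    · rintro ⟨h, hh, k⟩
      exact ⟨(g, h), ⟨hh, k⟩, rfl⟩
    · rintro ⟨⟨g, h⟩, ⟨hh, k⟩, rfl⟩
      exact ⟨h, hh, k⟩
  have hs : IsSigmaCompact (Spin101 : Set EndSpinorˣ) := by
    rw [h]
    exact (isSigmaCompact_univ.of_isClosed_subset isClosed_lifts (Set.subset_univ _)).image
      continuous_fst
  exact isSigmaCompact_iff_sigmaCompactSpace.1 hs

theorem isCoveringMap_spinHom : IsCoveringMap spinHom := by
  have ho : IsOpenMap spinHom :=
    spinHom.isOpenMap_of_sigmaCompact spinHom_surjective continuous_spinHom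
  have hq := ho.isQuotientMap continuous_spinHom spinHom_surjective
  refine (hq.isQuotientCoveringMap_of_isDiscrete_ker_monoidHom
    (Set.Finite.isDiscrete ?_)).isCoveringMap
  refine (Set.toFinite {1, negOne}).subset fun g hg => ?_
  exact (spinHom_eq_one_iff g).1 hg

/-! ### The squaring map -/

theorem quartic_eq (z : Spinor) : quartic z = -(1 / 4) * lor (squaring z) (squaring z) := by
  have h := inner_mul_mul_add (z 0) (z 2) (z 1) (z 3)
  have e : ⟪z 0 * z 3 + z 2 * z 1, z 0 * z 3 + z 2 * z 1⟫ =
      ‖z 0‖ ^ 2 * ‖z 3‖ ^ 2 + ‖z 2‖ ^ 2 * ‖z 1‖ ^ 2 + 2 * ⟪z 0 * z 3, z 2 * z 1⟫ := by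
    rw [real_inner_self_eq_norm_sq, norm_add_sq_real, norm_mul_sq, norm_mul_sq]; ring
  simp only [quartic, lor, squaring, real_inner_smul_left, real_inner_smul_right, e]
  linear_combination 2 * h

theorem lor_squaring_nonpos (z : Spinor) : lor (squaring z) (squaring z) ≤ 0 := by
  set s := ⟪z 0, z 2⟫ - ⟪z 1, z 3⟫ with hs
  set u := z 0 * z 3 + z 2 * z 1 with hu
  set n := s ^ 2 + ‖u‖ ^ 2 with hn
  set p := s • z 2 + u * C (z 3) with hp
  set q := C (z 2) * u - s • z 3 with hq
  have h1 : ⟪z 0, p⟫ + ⟪z 1, q⟫ = n := by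
    rw [hp, hq, inner_add_right, inner_sub_right, ← inner_mul_right, ← inner_mul_left,
      inner_smul_right, inner_smul_right, hn, ← real_inner_self_eq_norm_sq u]
    nth_rw 3 [hu]
    rw [inner_add_left, hs]
    ring
  have h2 : ‖p‖ ^ 2 + ‖q‖ ^ 2 = n * (‖z 2‖ ^ 2 + ‖z 3‖ ^ 2) := by
    rw [hp, hq, norm_add_sq_real, norm_sub_sq_real, norm_mul_sq, norm_mul_sq, norm_C, norm_C,
      norm_smul, norm_smul, real_inner_smul_left, real_inner_smul_right, ← inner_mul_right,
      real_inner_comm, mul_pow, mul_pow, Real.norm_eq_abs, sq_abs, inner_mul_left, C_C]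
    ring
  have h3 : n ^ 2 ≤ (‖z 0‖ ^ 2 + ‖z 1‖ ^ 2) * (‖p‖ ^ 2 + ‖q‖ ^ 2) := by
    have a0 := abs_le.1 (abs_real_inner_le_norm (z 0) p)
    have a1 := abs_le.1 (abs_real_inner_le_norm (z 1) q)
    have hn0 : 0 ≤ n := by positivity
    have a2 : n ≤ ‖z 0‖ * ‖p‖ + ‖z 1‖ * ‖q‖ := by linarith [a0.2, a1.2]
    calc n ^ 2 ≤ (‖z 0‖ * ‖p‖ + ‖z 1‖ * ‖q‖) ^ 2 := by gcongr
      _ ≤ _ := by nlinarith [sq_nonneg (‖z 0‖ * ‖q‖ - ‖z 1‖ * ‖p‖)]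
  have h4 : n ≤ (‖z 0‖ ^ 2 + ‖z 1‖ ^ 2) * (‖z 2‖ ^ 2 + ‖z 3‖ ^ 2) := by
    rcases eq_or_lt_of_le (show 0 ≤ n by positivity) with h0 | h0
    · rw [← h0]; positivity
    · rw [h2] at h3
      refine le_of_mul_le_mul_left ?_ h0
      linarith
  have h5 : lor (squaring z) (squaring z) =
      4 * (n - (‖z 0‖ ^ 2 + ‖z 1‖ ^ 2) * (‖z 2‖ ^ 2 + ‖z 3‖ ^ 2)) := by
    simp only [lor, squaring, real_inner_smul_left, real_inner_smul_right, hn, ← hs, ← hu]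
    rw [real_inner_self_eq_norm_sq]
    ring
  rw [h5]
  linarith

theorem exists_squaring_eq {b : Vec} (hb : lor b b ≤ 0) (hf : lor b timeAxis < 0) :
    ∃ z, squaring z = b := by
  obtain ⟨b₁, b₂, b₃, x⟩ := b
  rw [lor_timeAxis] at hf
  simp only [lor, real_inner_self_eq_norm_sq] at hb hf
  have hx := sq_nonneg ‖x‖
  have h2 := sq_nonneg b₂
  rcases lt_trichotomy b₁ 0 with h1 | h1 | h1
  · nlinarith
  · subst h1
    have hb2 : b₂ = 0 := by nlinarith
    have hx0 : x = 0 := by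
      rw [← norm_eq_zero]; nlinarith
    have h3 : 0 ≤ b₃ := by linarith
    subst hb2 hx0
    refine ⟨![0, 0, √b₃ • 1, 0], ?_⟩
    simp [squaring, norm_smul, norm_one', Real.sq_sqrt h3]
  · set r := √b₁ with hr
    have hr0 : 0 < r := Real.sqrt_pos.2 h1
    have hrr : r ^ 2 = b₁ := Real.sq_sqrt h1.le
    set c := b₃ - ‖x‖ ^ 2 / (4 * b₁) - b₂ ^ 2 / (4 * b₁) with hc
    have hc0 : 0 ≤ c := by
      rw [hc, sub_sub, ← add_div, sub_nonneg, div_le_iff₀ (by positivity)]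
      linarith
    let i : Octonion := Octonion.mk 0 1
    have hi : ⟪(1 : Octonion), i⟫ = 0 := by
      simp [Octonion.inner_eq, i, fst_mk, snd_mk, Octonion.fst_one, Octonion.snd_one]
    have hin : ‖i‖ ^ 2 = 1 := by
      rw [← real_inner_self_eq_norm_sq, Octonion.inner_eq]
      simp [i, fst_mk, snd_mk]
    refine ⟨![r • 1, 0, (b₂ / (2 * r)) • 1 + √c • i, (1 / (2 * r)) • x], ?_⟩
    have hn : ‖(b₂ / (2 * r)) • (1 : Octonion) + √c • i‖ ^ 2 = b₂ ^ 2 / (4 * b₁) + c := by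
      rw [norm_add_sq_real, norm_smul, norm_smul, real_inner_smul_left, real_inner_smul_right, hi,
        norm_one', mul_pow, mul_pow, hin, Real.norm_eq_abs, Real.norm_eq_abs, sq_abs, sq_abs,
        Real.sq_sqrt hc0, div_pow, mul_pow, hrr]
      ring
    have hn3 : ‖(1 / (2 * r)) • x‖ ^ 2 = ‖x‖ ^ 2 / (4 * b₁) := by
      rw [norm_smul, mul_pow, Real.norm_eq_abs, sq_abs, div_pow, mul_pow, hrr]
      ring
    refine Prod.ext ?_ (Prod.ext ?_ (Prod.ext ?_ ?_))
    · simp [squaring, norm_smul, norm_one', mul_pow, hrr]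
    · simp only [squaring, Matrix.cons_val_zero, Matrix.cons_val_one, Matrix.cons_val,
        inner_zero_left, inner_add_right, real_inner_smul_left, real_inner_smul_right, hi,
        real_inner_self_eq_norm_sq, norm_one']
      field_simp
      ring
    · simp only [squaring, Matrix.cons_val]
      rw [hn, hn3, hc]
      ring
    · simp only [squaring, Matrix.cons_val_zero, Matrix.cons_val_one, Matrix.cons_val, mul_zero,
        add_zero, smul_one_mul, smul_smul]
      rw [show 2 * (r * (1 / (2 * r))) = 1 by field_simp, one_smul]

theorem range_squaring : Set.range squaring = {0} ∪ forwardLightCone ∪ futureTimelike := by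
  ext b
  constructor
  · rintro ⟨z, rfl⟩
    by_cases hz : lor (squaring z) timeAxis < 0
    · rcases eq_or_lt_of_le (lor_squaring_nonpos z) with h | h
      · exact Or.inl (Or.inr ⟨h, hz⟩)
      · exact Or.inr ⟨h, hz⟩
    · refine Or.inl (Or.inl ?_)
      rw [lor_timeAxis] at hz
      simp only [squaring] at hz
      have n0 := sq_nonneg ‖z 0‖
      have n1 := sq_nonneg ‖z 1‖
      have n2 := sq_nonneg ‖z 2‖
      have n3 := sq_nonneg ‖z 3‖
      obtain ⟨z0, z1⟩ := norm_sq_add_norm_sq_eq_zero (x := z 0) (y := z 1) (by linarith)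
      obtain ⟨z2, z3⟩ := norm_sq_add_norm_sq_eq_zero (x := z 2) (y := z 3) (by linarith)
      simp [squaring, z0, z1, z2, z3]
  · rintro ((h | ⟨h, hf⟩) | ⟨h, hf⟩)
    · rw [Set.mem_singleton_iff.1 h]
      exact ⟨0, by simp [squaring]⟩
    · exact exists_squaring_eq h.le hf
    · exact exists_squaring_eq h.le hf

theorem squaring_smul (g : Spin101) (z : Spinor) : squaring (g • z) = spinHom g • squaring z :=
  lifts_spinHom g z

theorem quartic_smul (g : Spin101) (z : Spinor) : quartic (g • z) = quartic z := by
  rw [quartic_eq, quartic_eq, squaring_smul]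
  congr 1
  exact (SOUp101_le (spinHom g).2).2 _ _

theorem squaring_image_orbit (z : Spinor) :
    squaring '' MulAction.orbit Spin101 z = MulAction.orbit SOUp101 (squaring z) := by
  ext b
  constructor
  · rintro ⟨_, ⟨g, rfl⟩, rfl⟩
    exact ⟨spinHom g, (squaring_smul g z).symm⟩
  · rintro ⟨h, rfl⟩
    obtain ⟨g, rfl⟩ := spinHom_surjective h
    exact ⟨g • z, ⟨g, rfl⟩, squaring_smul g z⟩

end Bryant
end

theorem mainTheorem6 :
    ∃ ρ : Bryant.Spin101 →* Bryant.SOUp101,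
      (Bryant.InducesOnLieAlgebras ρ ∧
        ∀ ρ₂ : Bryant.Spin101 →* Bryant.SOUp101, Bryant.InducesOnLieAlgebras ρ₂ → ρ₂ = ρ) ∧
      (IsCoveringMap ρ ∧ ∀ w : Bryant.SOUp101, (ρ ⁻¹' {w}).ncard = 2) ∧
      (∀ (g : Bryant.Spin101) (z : Bryant.Spinor),
        Bryant.squaring (g • z) = ρ g • Bryant.squaring z) ∧
      (∀ z : Bryant.Spinor,
        Bryant.quartic z = -(1 / 4) * Bryant.lor (Bryant.squaring z) (Bryant.squaring z)) ∧
      (∀ (g : Bryant.Spin101) (z : Bryant.Spinor), Bryant.quartic (g • z) = Bryant.quartic z) ∧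
      (∀ z : Bryant.Spinor,
        Bryant.squaring '' MulAction.orbit Bryant.Spin101 z =
          MulAction.orbit Bryant.SOUp101 (Bryant.squaring z)) ∧
      Set.range Bryant.squaring =
        {0} ∪ Bryant.forwardLightCone ∪ Bryant.futureTimelike := by
  exact ⟨Bryant.spinHom,
    ⟨Bryant.inducesOnLieAlgebras_spinHom, fun _ h => h.eq Bryant.inducesOnLieAlgebras_spinHom⟩,
    ⟨Bryant.isCoveringMap_spinHom, Bryant.preimage_spinHom⟩, Bryant.squaring_smul,
    Bryant.quartic_eq, Bryant.quartic_smul, Bryant.squaring_image_orbit, Bryant.range_squaring⟩
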